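/- **Dual Cauchy identity.** Let $\Bbbk$ be a field that is complete with respect to a multiplicative norm $|\cdot|$ (for instance $\mathbb{C}$), let $q\in\Bbbk$ satisfy $q^k\neq 1$ for all $k\ge 1$, and let $\mathbf u=(u_1,u_2,\dots)$, $\mathbf v=(v_1,v_2,\dots)$ be sequences in $\Bbbk$ with $u_kv_kq^s\ne1$ for all $k\ge1$, $s\ge0$. Write $(a;q)_k=\prod_{i=0}^{k-1}(1-aq^i)$ and $\binom{a}{b}_q=\frac{(q;q)_a}{(q;q)_{a-b}(q;q)_b}$ for $b\le a$. *Vertex weights.* A vertex has a bottom label $a$, a left label $b$, a top label $c$ and a right label $d$ (non-negative integers). (i) For $b,d\in\{0,1\}$ put $$\mathrm W_{x;(u,v)}(m,0,m,0)=\tfrac{1+uxq^m}{1+ux},\quad \mathrm W_{x;(u,v)}(m,0,m-1,1)=\tfrac{(1-q^m)x}{1+ux}\ (m\ge1),$$ $$\mathrm W_{x;(u,v)}(m,1,m+1,0)=\tfrac{1-uvq^m}{1+ux},\quad \mathrm W_{x;(u,v)}(m,1,m,1)=\tfrac{x+vq^m}{1+ux},$$ and $\mathrm W_{x;(u,v)}=0$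 on all other labels. (ii) Put $\mathbb W_{x;(u,v)}(a,b,c,d)=0$ unless $a+b=c+d$, and in that case $$\mathbb W_{x;(u,v)}(a,b,c,d)=x^d\sum_{p=0}^{\min(b,c)}(ux;q)_{c-p}\,(v/x;q)_p\,(v/x)^{b-p}\binom{c+d-p}{c-p}_q\binom bp_q ,$$ which for fixed labels is a polynomial in $x$; at $x=0$ it means the value of that polynomial. *Lattices.* For a partition $\kappa$ let $m_k(\kappa)$ be the number of its rows of length $k$, and let $\kappa'$ be its conjugate. Take a lattice with $n$ rows and with columns $k=1,2,3,\dots$ numbered from right to left. The $i$-th row from the top carries the variable $x_i$ and column $k$ carries the parameters $(u_k,v_k)$. The left boundary labels are $0$, the right boundary labels are free, and in every row only finitely many horizontal labels are non-zero. The weight of a configuration is the product of its vertex weights, and the partition function is the sum of these weights over all configurations with given bottom and top labels. For partitions $\kappa,\nu$ let $\mathfrak J^{(\mathbf u,\mathbf v)}_{\kappa/\nu}(x_1,\dots,x_n)$ be the partition function with weights $\mathrm W$, bottom labels $m_k(\kappa)$ and top labels $m_k(\nu)$. Let $\mathfrak G^{(\mathbf u,\mathbf v)}_{\kappa/\nu}(x_1,\dots,x_n)$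 be the partition function with weights $\mathbb W$, bottom labels $m_k(\kappa')$ and top labels $m_k(\nu')$. Put $$c_\kappa=\prod_{k\ge1}\frac{(u_kv_k;q)_{m_k(\kappa)}}{(q;q)_{m_k(\kappa)}} .$$ *Theorem.* Let $n,m\ge 0$ be integers, let $\lambda,\mu$ be partitions, and let $x_1,\dots,x_n,y_1,\dots,y_m\in\Bbbk$ with $1+v_ky_j\neq0$ for all $k\ge1$ and $1\le j\le m$. Assume that at least one of the following two conditions holds: (a) $v_k=0$ for infinitely many $k$; (b) there are real numbers $C$ and $\rho<1$ such that for all sufficiently large $k$ one has $|u_k|\le C$ and $|v_k|\le C$, and for all $j$ $$\left|\frac1{1+v_ky_j}\right|\le C,\qquad \left|v_k\,\frac{y_j+u_k}{1+v_ky_j}\right|\le\rho .$$ Then $$\sum_{\kappa\supseteq\lambda,\ \kappa\supseteq\mu}\frac{c_{\kappa'}}{c_{\mu'}}\,\mathfrak G^{(\mathbf u,\mathbf v)}_{\kappa/\lambda}(x_1,\dots,x_n)\,\mathfrak J^{(\mathbf v,\mathbf u)}_{\kappa'/\mu'}(y_1,\dots,y_m)=\prod_{j=1}^m\prod_{i=1}^n(1+x_iy_j)\sum_{\kappa\subseteq\lambda,\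 \kappa\subseteq\mu}\frac{c_{\lambda'}}{c_{\kappa'}}\,\mathfrak G^{(\mathbf u,\mathbf v)}_{\mu/\kappa}(x_1,\dots,x_n)\,\mathfrak J^{(\mathbf v,\mathbf u)}_{\lambda'/\kappa'}(y_1,\dots,y_m),$$ where the (in general infinite) sum on the left converges unconditionally and the sum on the right is finite. -/

import Mathlib

open Filter

namespace LatticeCauchy

noncomputable section

variable {𝕜 : Type*}

/-! ### `q`-series -/

/-- The `q`-Pochhammer symbol `(a;q)_k = (1 - a)(1 - a q) ⋯ (1 - a q^(k-1))`. -/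
def qPoch [Field 𝕜] (q a : 𝕜) (k : ℕ) : 𝕜 := ∏ i ∈ Finset.range k, (1 - a * q ^ i)

/-- The `q`-binomial coefficient `(q;q)_a / ((q;q)_(a-b) (q;q)_b)`, zero for `b > a`. -/
def qBinom [Field 𝕜] (q : 𝕜) (a b : ℕ) : 𝕜 :=
  if b ≤ a then qPoch q q a / (qPoch q q (a - b) * qPoch q q b) else 0

/-! ### Vertex weights

A vertex `(a, b, c, d)` has bottom label `a`, left label `b`, top label `c`, right label `d`. -/

/-- The weights with horizontal labels in `{0, 1}`, for row parameter `x` and column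
parameters `(u, v)`. All vertices that are not listed have weight zero. -/
def hlWeight [Field 𝕜] (q x u v : 𝕜) : ℕ → ℕ → ℕ → ℕ → 𝕜
  | a, 0, c, 0 => if c = a then (1 + u * x * q ^ a) / (1 + u * x) else 0
  | a, 0, c, 1 => if c + 1 = a then (1 - q ^ a) * x / (1 + u * x) else 0
  | a, 1, c, 0 => if c = a + 1 then (1 - u * v * q ^ a) / (1 + u * x) else 0
  | a, 1, c, 1 => if c = a then (x + v * q ^ a) / (1 + u * x) else 0
  | _, _, _, _ => 0

/-- The weights with arbitrary horizontal labels, for row parameter `x` and column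
parameters `(u, v)`:
`x^d ∑_p (ux;q)_(c-p) (v/x;q)_p (x/v)^(p-b) [c+d-p, c-p]_q [b, p]_q`, `0 ≤ p ≤ min b c`,
if `a + b = c + d`, and zero otherwise. The factor `(x/v)^(p-b)` is written `(v/x)^(b-p)`, so
that `v = 0` is allowed. For fixed labels this is a polynomial in `x` (see `qwWeight_eq`); the
branch `x = 0` is the value of that polynomial at zero. -/
def qwWeight [Field 𝕜] [DecidableEq 𝕜] (q x u v : 𝕜) (a b c d : ℕ) : 𝕜 :=
  if a + b = c + d then
    if x = 0 then
      if a ≤ c then qBinom q b (c - a) * qPoch q (u * v * q ^ a) (c - a) * (v * q ^ a) ^ d else 0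
    else
      x ^ d * ∑ p ∈ Finset.range (min b c + 1),
        qPoch q (u * x) (c - p) * qPoch q (v / x) p * (v / x) ^ (b - p) *
          qBinom q (c + d - p) (c - p) * qBinom q b p
  else 0

/-! ### Lattices with infinitely many columns

Column number `k : ℕ` is the site `k + 1`, counted from the right. A basis state
`|i_1⟩ ⊗ |i_2⟩ ⊗ ⋯` is the finitely supported sequence of its labels. -/

/-- The matrix element of a one-row transfer matrix: the partition function of one row with
bottom labels `a` and top labels `c`. A configuration is a finitely supported sequence `h`; `h k`
is the label on the right edge of column `k`, so `h (k + 1)` is the one on its left edge. Far to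
the left the labels vanish, and the label `h 0` of the right boundary is free. By conservation at
most one `h` contributes. -/
def rowZ [Field 𝕜] (w : ℕ → ℕ → ℕ → ℕ → ℕ → 𝕜) (a c : ℕ →₀ ℕ) : 𝕜 :=
  ∑ᶠ h : ℕ →₀ ℕ, ∏ᶠ k : ℕ, w k (a k) (h (k + 1)) (c k) (h k)

/-- The partition function `⟨a| T(x_n) ⋯ T(x_1) |c⟩` of `n` rows, with bottom labels `a` and top
labels `c`; the row of `x_1` is the top row. Here `w x k` is the vertex weight of column `k` in a
row with parameter `x`. -/
def latticeZ [Field 𝕜] (w : 𝕜 → ℕ → ℕ → ℕ → ℕ → ℕ → 𝕜) :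
    (n : ℕ) → (Fin n → 𝕜) → (ℕ →₀ ℕ) → (ℕ →₀ ℕ) → 𝕜
  | 0, _, a, c => if a = c then 1 else 0
  | n + 1, x, a, c =>
      ∑ᶠ b : ℕ →₀ ℕ, rowZ (w (x (Fin.last n))) a b * latticeZ w n (fun i => x i.castSucc) b c

/-! ### Partitions and the two families -/

/-- The sequence of multiplicities of a partition: its value at `k` is `m_(k+1)(κ)`, the number of
rows of length `k + 1`. -/
def mult (κ : YoungDiagram) : ℕ →₀ ℕ :=
  Finsupp.onFinset (Finset.range (κ.rowLen 0)) (fun k => κ.rowLens.count (k + 1)) (by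
    intro k hk
    have h : k + 1 ∈ κ.rowLens := List.count_pos_iff.mp (Nat.pos_of_ne_zero hk)
    obtain ⟨i, -, hi⟩ := List.mem_map.mp h
    have := κ.rowLen_anti 0 i (Nat.zero_le i)
    rw [Finset.mem_range]
    omega)

/-- The Hall--Littlewood type function `𝔍^(u,v)_(κ/ν)(x_1, …, x_n)`. -/
def frakJ [Field 𝕜] (q : 𝕜) (u v : ℕ → 𝕜) (κ ν : YoungDiagram) {n : ℕ} (x : Fin n → 𝕜) : 𝕜 :=
  latticeZ (fun z k => hlWeight q z (u k) (v k)) n x (mult κ) (mult ν)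

/-- The `q`-Whittaker type polynomial `𝔊^(u,v)_(κ/ν)(x_1, …, x_n)`. -/
def frakG [Field 𝕜] [DecidableEq 𝕜] (q : 𝕜) (u v : ℕ → 𝕜) (κ ν : YoungDiagram) {n : ℕ}
    (x : Fin n → 𝕜) : 𝕜 :=
  latticeZ (fun z k => qwWeight q z (u k) (v k)) n x (mult κ.transpose) (mult ν.transpose)

/-- `c_κ = ∏_(i ≥ 1) (u_i v_i; q)_(m_i(κ)) / (q; q)_(m_i(κ))`; the factors with `i > κ_1` are
equal to `1`. -/
def cCoeff [Field 𝕜] (q : 𝕜) (u v : ℕ → 𝕜) (κ : YoungDiagram) : 𝕜 :=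
  ∏ k ∈ Finset.range (κ.rowLen 0), qPoch q (u k * v k) (mult κ k) / qPoch q q (mult κ k)

/-! ### Facts that support the definitions -/

/-- Only finitely many partitions are contained in a given one. -/
theorem finite_contained (lam mu : YoungDiagram) :
    {κ : YoungDiagram | κ ≤ lam ∧ κ ≤ mu}.Finite := by
  refine Set.Finite.of_finite_image (f := YoungDiagram.cells) ?_ ?_
  · refine (Finset.finite_toSet lam.cells.powerset).subset ?_
    rintro _ ⟨κ, hκ, rfl⟩
    simpa using YoungDiagram.cells_subset_iff.mpr hκ.1
  · intro a _ b _ h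
    exact YoungDiagram.ext h

theorem qPoch_succ [Field 𝕜] (q a : 𝕜) (k : ℕ) :
    qPoch q a (k + 1) = qPoch q a k * (1 - a * q ^ k) := by
  simp [qPoch, Finset.prod_range_succ]

theorem qPoch_self_ne_zero [Field 𝕜] {q : 𝕜} (hq : ∀ k : ℕ, q ^ (k + 1) ≠ 1) (k : ℕ) :
    qPoch q q k ≠ 0 := by
  refine Finset.prod_ne_zero_iff.mpr fun i _ h => hq i ?_
  rw [pow_succ']
  exact (sub_eq_zero.mp h).symm

theorem qBinom_of_lt [Field 𝕜] (q : 𝕜) {a b : ℕ} (h : a < b) : qBinom q a b = 0 := by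
  simp [qBinom, h]

theorem qBinom_zero_right [Field 𝕜] {q : 𝕜} (hq : ∀ k : ℕ, q ^ (k + 1) ≠ 1) (a : ℕ) :
    qBinom q a 0 = 1 := by
  have h0 : qPoch q q 0 = 1 := by simp [qPoch]
  simp [qBinom, h0, qPoch_self_ne_zero hq a]

theorem qBinom_self [Field 𝕜] {q : 𝕜} (hq : ∀ k : ℕ, q ^ (k + 1) ≠ 1) (a : ℕ) :
    qBinom q a a = 1 := by
  have h0 : qPoch q q 0 = 1 := by simp [qPoch]
  simp [qBinom, h0, qPoch_self_ne_zero hq a]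

/-- The `q`-Pascal recursion. -/
theorem qBinom_succ_succ [Field 𝕜] {q : 𝕜} (hq : ∀ k : ℕ, q ^ (k + 1) ≠ 1) (a b : ℕ) :
    qBinom q (a + 1) (b + 1) = qBinom q a b + q ^ (b + 1) * qBinom q a (b + 1) := by
  rcases lt_trichotomy a b with h | rfl | h
  · rw [qBinom_of_lt q h, qBinom_of_lt q (by omega : a + 1 < b + 1),
      qBinom_of_lt q (by omega : a < b + 1)]
    simp
  · rw [qBinom_self hq, qBinom_self hq, qBinom_of_lt q (Nat.lt_succ_self a)]
    simp
  · obtain ⟨r, rfl⟩ := Nat.exists_eq_add_of_lt h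
    have e1 : b + r + 1 + 1 - (b + 1) = r + 1 := by omega
    have e2 : b + r + 1 - b = r + 1 := by omega
    have e3 : b + r + 1 - (b + 1) = r := by omega
    have h1 := qPoch_self_ne_zero hq r
    have h2 := qPoch_self_ne_zero hq b
    have h3 := qPoch_self_ne_zero hq (r + 1)
    have h4 := qPoch_self_ne_zero hq (b + 1)
    simp only [qBinom, if_pos (by omega : b + 1 ≤ b + r + 1 + 1),
      if_pos (by omega : b ≤ b + r + 1), if_pos (by omega : b + 1 ≤ b + r + 1), e1, e2, e3]
    rw [qPoch_succ] at h3 h4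
    rw [qPoch_succ q q (b + r + 1), qPoch_succ q q r, qPoch_succ q q b]
    have h5 := right_ne_zero_of_mul h3
    have h6 := right_ne_zero_of_mul h4
    field_simp
    ring

/-- The sum in the vertex weight, with `t = u x` and `s = v / x`. -/
def weightSum [Field 𝕜] (q t s : 𝕜) (a b c : ℕ) : 𝕜 :=
  ∑ p ∈ Finset.range (c + 1),
    qPoch q t (c - p) * qPoch q s p * s ^ (b - p) * qBinom q (a + b - p) (c - p) * qBinom q b p

/-- The vertex weight as a polynomial. -/
def weightPoly [Field 𝕜] (q x u v : 𝕜) (a b c : ℕ) : 𝕜 :=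
  ∑ k ∈ Finset.range (c + 1),
    qBinom q a k * qPoch q (u * x) k * x ^ (a - k) * qBinom q b (c - k) *
      qPoch q (u * v * q ^ k) (c - k) * (v * q ^ k) ^ (b - (c - k))

theorem weightSum_zero [Field 𝕜] {q : 𝕜} (hq : ∀ k : ℕ, q ^ (k + 1) ≠ 1) (t s : 𝕜) (a c : ℕ) :
    weightSum q t s a 0 c = qPoch q t c * qBinom q a c := by
  rw [weightSum, Finset.sum_range_succ', Finset.sum_eq_zero]
  · simp [qBinom_self hq, qPoch]
  · intro p _
    simp [qBinom_of_lt q (Nat.succ_pos p)]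

theorem weightSum_succ_zero [Field 𝕜] {q : 𝕜} (hq : ∀ k : ℕ, q ^ (k + 1) ≠ 1) (t s : 𝕜)
    (a b : ℕ) : weightSum q t s a (b + 1) 0 = s * weightSum q t s a b 0 := by
  simp [weightSum, qBinom_zero_right hq, pow_succ, mul_comm, qPoch]

theorem weightSum_succ_succ [Field 𝕜] {q : 𝕜} (hq : ∀ k : ℕ, q ^ (k + 1) ≠ 1) (t s : 𝕜)
    (a b c : ℕ) :
    weightSum q t s a (b + 1) (c + 1) =
      s * q ^ (c + 1) * weightSum q t s a b (c + 1) +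
        (1 - t * s * q ^ c) * weightSum q t s a b c := by
  have hL : weightSum q t s a (b + 1) (c + 1) =
      (∑ p ∈ Finset.range (c + 1 + 1), qPoch q t (c + 1 - p) * qPoch q s p * s ^ (b + 1 - p) *
        qBinom q (a + (b + 1) - p) (c + 1 - p) * (q ^ p * qBinom q b p)) +
      ∑ p ∈ Finset.range (c + 1), qPoch q t (c - p) * qPoch q s (p + 1) * s ^ (b - p) *
        qBinom q (a + b - p) (c - p) * qBinom q b p := by
    rw [weightSum, Finset.sum_range_succ', Finset.sum_range_succ' _ (c + 1), add_right_comm,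
      ← Finset.sum_add_distrib]
    congr 1
    · refine Finset.sum_congr rfl fun p _ => ?_
      rw [qBinom_succ_succ hq b p, Nat.add_sub_add_right, Nat.add_sub_add_right,
        ← add_assoc, Nat.add_sub_add_right]
      ring
    · simp [qBinom_zero_right hq]
  rw [hL, Finset.sum_range_succ _ (c + 1), weightSum, Finset.sum_range_succ _ (c + 1), weightSum,
    mul_add,
    Finset.mul_sum, Finset.mul_sum, add_right_comm, add_right_comm _ (s * q ^ (c + 1) * _),
    ← Finset.sum_add_distrib, ← Finset.sum_add_distrib]
  congr 1
  · refine Finset.sum_congr rfl fun p hp => ?_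
    rw [Finset.mem_range] at hp
    rcases lt_or_ge b p with hb | hb
    · simp [qBinom_of_lt q hb]
    · obtain ⟨r, rfl⟩ := Nat.exists_eq_add_of_le hb
      obtain ⟨e, rfl⟩ := Nat.exists_eq_add_of_le (Nat.lt_succ_iff.mp hp)
      have e1 : p + e + 1 - p = e + 1 := by omega
      have e2 : p + e - p = e := by omega
      have e3 : p + r + 1 - p = r + 1 := by omega
      have e4 : p + r - p = r := by omega
      have e5 : a + (p + r + 1) - p = a + r + 1 := by omega
      have e6 : a + (p + r) - p = a + r := by omega
      rw [e1, e2, e3, e4, e5, e6, qBinom_succ_succ hq, qPoch_succ, qPoch_succ]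
      ring
  · rcases lt_or_ge b (c + 1) with hb | hb
    · simp [qBinom_of_lt q hb]
    · rw [Nat.sub_self, qBinom_zero_right hq, qBinom_zero_right hq, Nat.sub_add_comm hb]
      ring

theorem weightPoly_zero [Field 𝕜] {q : 𝕜} (hq : ∀ k : ℕ, q ^ (k + 1) ≠ 1) (x u v : 𝕜)
    (a c : ℕ) :
    weightPoly q x u v a 0 c = qBinom q a c * qPoch q (u * x) c * x ^ (a - c) := by
  rw [weightPoly, Finset.sum_range_succ, Finset.sum_eq_zero]
  · simp [qBinom_self hq, qPoch]
  · intro k hk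
    rw [Finset.mem_range] at hk
    simp [qBinom_of_lt q (Nat.sub_pos_of_lt hk)]

theorem weightPoly_succ_zero [Field 𝕜] {q : 𝕜} (hq : ∀ k : ℕ, q ^ (k + 1) ≠ 1) (x u v : 𝕜)
    (a b : ℕ) : weightPoly q x u v a (b + 1) 0 = v * weightPoly q x u v a b 0 := by
  simp [weightPoly, qBinom_zero_right hq, pow_succ, qPoch]
  ring

theorem weightPoly_succ_succ [Field 𝕜] {q : 𝕜} (hq : ∀ k : ℕ, q ^ (k + 1) ≠ 1) (x u v : 𝕜)
    (a b c : ℕ) :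
    weightPoly q x u v a (b + 1) (c + 1) =
      v * q ^ (c + 1) * weightPoly q x u v a b (c + 1) +
        (1 - u * v * q ^ c) * weightPoly q x u v a b c := by
  rw [weightPoly, Finset.sum_range_succ _ (c + 1), weightPoly, Finset.sum_range_succ _ (c + 1),
    weightPoly, mul_add,
    Finset.mul_sum, Finset.mul_sum, add_right_comm, ← Finset.sum_add_distrib]
  congr 1
  · refine Finset.sum_congr rfl fun k hk => ?_
    obtain ⟨e, rfl⟩ := Nat.exists_eq_add_of_le (Nat.lt_succ_iff.mp (Finset.mem_range.mp hk))
    have e1 : k + e + 1 - k = e + 1 := by omega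
    have e2 : k + e - k = e := by omega
    rw [e1, e2, qBinom_succ_succ hq, qPoch_succ, Nat.add_sub_add_right]
    rcases lt_or_ge b (e + 1) with hb | hb
    · rw [qBinom_of_lt q hb]
      ring
    · rw [← Nat.sub_add_cancel (by omega : 1 ≤ b - e), Nat.sub_sub]
      ring
  · simp only [Nat.sub_self, Nat.sub_zero, qBinom_zero_right hq, qPoch, Finset.prod_range_zero]
    ring

theorem weightSum_eq_weightPoly [Field 𝕜] {q : 𝕜} (hq : ∀ k : ℕ, q ^ (k + 1) ≠ 1) {x : 𝕜}
    (hx : x ≠ 0) (u v : 𝕜) (a b c : ℕ) :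
    x ^ (a + b) * weightSum q (u * x) (v / x) a b c = x ^ c * weightPoly q x u v a b c := by
  have hs : x * (v / x) = v := mul_div_cancel₀ v hx
  have hts : u * x * (v / x) = u * v := by rw [mul_assoc, hs]
  induction b generalizing c with
  | zero =>
    rw [weightSum_zero hq, weightPoly_zero hq]
    rcases lt_or_ge a c with h | h
    · simp [qBinom_of_lt q h]
    · nth_rewrite 1 [← Nat.add_sub_cancel' h]
      rw [add_zero, pow_add]
      ring
  | succ b ih =>
    rcases c with _ | c
    · rw [weightSum_succ_zero hq, weightPoly_succ_zero hq]
      linear_combination x * (v / x) * ih 0 + weightPoly q x u v a b 0 * hs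
    · rw [weightSum_succ_succ hq, weightPoly_succ_succ hq, hts]
      linear_combination x * (v / x) * q ^ (c + 1) * ih (c + 1) +
        x * (1 - u * v * q ^ c) * ih c +
        x ^ (c + 1) * q ^ (c + 1) * weightPoly q x u v a b (c + 1) * hs

/-- The vertex weight is the value at `x` of a polynomial, for every `x`. -/
theorem qwWeight_eq [Field 𝕜] [DecidableEq 𝕜] {q : 𝕜} (hq : ∀ k : ℕ, q ^ (k + 1) ≠ 1)
    (x u v : 𝕜) {a b c d : ℕ} (h : a + b = c + d) :
    qwWeight q x u v a b c d = weightPoly q x u v a b c := by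
  rw [qwWeight, if_pos h]
  split_ifs with hx hac
  · rw [weightPoly, Finset.sum_eq_single a]
    · have : b - (c - a) = d := by omega
      simp [hx, this, qBinom_self hq, qPoch]
    · intro k _ hk
      rcases lt_or_gt_of_ne hk with h1 | h1
      · simp [hx, Nat.sub_ne_zero_of_lt h1]
      · simp [qBinom_of_lt q h1]
    · intro h1
      exact absurd (Finset.mem_range.mpr (by omega)) h1
  · rw [weightPoly, Finset.sum_eq_zero]
    intro k hk
    rw [Finset.mem_range] at hk
    simp [hx, Nat.sub_ne_zero_of_lt (by omega : k < a)]
  · have h1 : weightSum q (u * x) (v / x) a b c = ∑ p ∈ Finset.range (min b c + 1),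
        qPoch q (u * x) (c - p) * qPoch q (v / x) p * (v / x) ^ (b - p) *
          qBinom q (c + d - p) (c - p) * qBinom q b p := by
      rw [weightSum, h]
      symm
      refine Finset.sum_subset (fun p hp => ?_) fun p hp hp' => ?_
      · rw [Finset.mem_range] at hp ⊢
        omega
      · rw [Finset.mem_range] at hp hp'
        simp [qBinom_of_lt q (by omega : b < p)]
    rw [← h1]
    have h2 := weightSum_eq_weightPoly hq hx u v a b c
    rw [h, pow_add, mul_assoc] at h2
    exact mul_left_cancel₀ (pow_ne_zero c hx) h2

theorem hlWeight_empty [Field 𝕜] (q x u v : 𝕜) (h : 1 + u * x ≠ 0) :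
    hlWeight q x u v 0 0 0 0 = 1 := by
  simp [hlWeight, h]

theorem qwWeight_empty [Field 𝕜] [DecidableEq 𝕜] (q x u v : 𝕜) :
    qwWeight q x u v 0 0 0 0 = 1 := by
  by_cases hx : x = 0 <;> simp [qwWeight, hx, qPoch, qBinom]

end

end LatticeCauchy

open Filter

namespace LatticeCauchy

noncomputable section

/-! ### Contiguous relations for the vertex weight -/

section Contiguous

variable {𝕜 : Type*} [Field 𝕜] {q : 𝕜}

/-! Encode a partition by its label sequence and read both sides as entries of matrix products. Let
`Q` be the product of the one-row matrices `gRow`, and `P` the product of the transposed one-row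
matrices `jRow`, conjugated by the coefficients `c`. The identity is the entry (μ, λ) of `P Q = ∏ (1
+ x_i y_j) Q P`. It therefore follows from the commutation of two single rows, `kmul_jRow_gRow`,
once products of infinite matrices are known to be associative.

Two rows are commuted by a Yang–Baxter argument. Keep only the first `N` columns from the right, and
let `F s` and `F' s` be the partition functions of the two stackings with left label `s` in the dual
row. The two linear relations `Exchange` between `F` and `F'` act as a crossing of the two rows.
They hold for no columns because the right boundary is free, and `Exchange.step` carries them over
one more column by means of three contiguous relations for `weightPoly`. To the left of all vertical
labels one gets `F 0 + x y F 1 = (1 + x y) F' 0`. Here `F 0` is a partial sum of an entry of the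
product of `jRow` and `gRow`, and `F' 0` is the entry of the opposite product. Each further empty
column multiplies `F 1` by `v (y + u) / (1 + v y)`, so either convergence condition forces `F 1` to
tend to zero.

Associativity comes from a class of growth functions that all the matrices of absolute values
preserve: functions of bounded support under condition (a), functions bounded by a multiplicative
weight `tailWeight` under condition (b). The weight is chosen in `exists_isGrowthClass_preserves`.
-/

theorem qBinom_succ_mul (hq : ∀ k : ℕ, q ^ (k + 1) ≠ 1) (a b : ℕ) :
    (1 - q ^ (b + 1)) * qBinom q (a + 1) (b + 1) = (1 - q ^ (a + 1)) * qBinom q a b := by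
  rcases lt_or_ge a b with h | h
  · simp [qBinom_of_lt q h, qBinom_of_lt q (Nat.succ_lt_succ h)]
  · have h1 := qPoch_self_ne_zero hq (b + 1)
    have h2 := qPoch_self_ne_zero hq (a - b)
    have h3 := qPoch_self_ne_zero hq b
    simp only [qBinom, if_pos h, if_pos (Nat.succ_le_succ h), Nat.add_sub_add_right]
    rw [qPoch_succ] at h1
    rw [qPoch_succ q q a, qPoch_succ q q b]
    have h4 := right_ne_zero_of_mul h1
    rw [pow_succ', pow_succ']
    field_simp

theorem qBinom_add_mul (hq : ∀ k : ℕ, q ^ (k + 1) ≠ 1) (b r : ℕ) :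
    (1 - q ^ (r + 1)) * qBinom q (b + r + 1) b = (1 - q ^ (b + r + 1)) * qBinom q (b + r) b := by
  have h1 := qPoch_self_ne_zero hq (r + 1)
  have h2 := qPoch_self_ne_zero hq b
  have e1 : b + r + 1 - b = r + 1 := by omega
  have e2 : b + r - b = r := by omega
  simp only [qBinom, if_pos (by omega : b ≤ b + r + 1), if_pos (by omega : b ≤ b + r), e1, e2]
  rw [qPoch_succ] at h1
  rw [qPoch_succ q q (b + r), qPoch_succ q q r]
  have h3 := left_ne_zero_of_mul h1
  have h4 := right_ne_zero_of_mul h1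
  rw [pow_succ', pow_succ']
  field_simp

theorem qBinom_mul_succ (hq : ∀ k : ℕ, q ^ (k + 1) ≠ 1) (b r : ℕ) :
    (1 - q ^ (b + 1)) * qBinom q (b + r) (b + 1) = (1 - q ^ r) * qBinom q (b + r) b := by
  rcases r with _ | r
  · simp [qBinom_of_lt q (Nat.lt_succ_self b)]
  · rw [← add_assoc, qBinom_succ_mul hq, qBinom_add_mul hq]

theorem weightPoly_of_lt (q x u v : 𝕜) {a b c : ℕ} (h : a + b < c) :
    weightPoly q x u v a b c = 0 := by
  refine Finset.sum_eq_zero fun k _ => ?_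
  rcases lt_or_ge a k with h1 | h1
  · simp [qBinom_of_lt q h1]
  · simp [qBinom_of_lt q (by omega : b < c - k)]

/-- The recursion in the left label has coefficients free of `a` and `x`, so shifts of `a` pass
through it and induction on `b` applies; the remaining powers of `q` match by conservation. The
truncated predecessors at `a = 0` or `b = 0` carry the vanishing factors `1 - q ^ a` and `1 - q ^
b`. -/
theorem weightPoly_contiguous_sub (hq : ∀ k : ℕ, q ^ (k + 1) ≠ 1) (x u v : 𝕜) {a b c d : ℕ}
    (h : a + b = c + d) :
    (1 - q ^ d) * weightPoly q x u v a b c =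
      v * q ^ a * (1 - q ^ b) * weightPoly q x u v a (b - 1) c +
        x * (1 - q ^ a) * weightPoly q x u v (a - 1) b c := by
  induction b generalizing c d with
  | zero =>
    rcases a with _ | a
    · have : d = 0 := by omega
      simp [this]
    rcases d with _ | d
    · simp [weightPoly_of_lt q x u v (by omega : a + 0 < c)]
    obtain rfl : a = c + d := by omega
    have e1 : c + d + 1 - c = d + 1 := by omega
    have e2 : c + d - c = d := by omega
    rw [weightPoly_zero hq, Nat.add_sub_cancel, weightPoly_zero hq, e1, e2]
    linear_combination qPoch q (u * x) c * x ^ (d + 1) * qBinom_add_mul hq c d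
  | succ b ih =>
    rcases d with _ | d
    · rw [Nat.add_sub_cancel, weightPoly_of_lt q x u v (by omega : a + b < c)]
      rcases a with _ | a
      · simp
      · simp [weightPoly_of_lt q x u v (by omega : a + (b + 1) < c)]
    have hp : q ^ c * q ^ d = q ^ a * q ^ b := by
      rw [← pow_add, ← pow_add, show c + d = a + b by omega]
    have i1 := ih (c := c) (d := d) (by omega)
    rcases c with _ | c
    · rw [Nat.add_sub_cancel, weightPoly_succ_zero hq, weightPoly_succ_zero hq]
      -- The factor `1 - q ^ b` makes the recursion usable at `b = 0`, where `b - 1` is truncated.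
      have hr : (1 - q ^ b) * weightPoly q x u v a b 0 =
          (1 - q ^ b) * (v * weightPoly q x u v a (b - 1) 0) := by
        rcases b with _ | b
        · simp
        · rw [weightPoly_succ_zero hq, Nat.add_sub_cancel]
      rw [pow_zero, one_mul] at hp
      linear_combination v * i1 - v * q ^ a * hr - v * (q - 1) * weightPoly q x u v a b 0 * hp
    · have i2 := ih (c := c) (d := d + 1) (by omega)
      rw [Nat.add_sub_cancel, weightPoly_succ_succ hq, weightPoly_succ_succ hq]
      have hr : (1 - q ^ b) * weightPoly q x u v a b (c + 1) =
          (1 - q ^ b) * (v * q ^ (c + 1) * weightPoly q x u v a (b - 1) (c + 1) +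
            (1 - u * v * q ^ c) * weightPoly q x u v a (b - 1) c) := by
        rcases b with _ | b
        · simp
        · rw [weightPoly_succ_succ hq, Nat.add_sub_cancel]
      linear_combination v * q ^ (c + 1) * i1 + (1 - u * v * q ^ c) * i2 - v * q ^ a * hr -
        v * (q - 1) * weightPoly q x u v a b (c + 1) * hp

/-- Eliminates the vertex whose bottom label is raised when the dual row below it has labels 0 on
the left and 1 on the right. The induction is again on `b`; the base case is the `q`-Pascal rule. -/
theorem weightPoly_contiguous_add (hq : ∀ k : ℕ, q ^ (k + 1) ≠ 1) (x u v : 𝕜) {a b c d : ℕ}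
    (h : a + b + 1 = c + d) :
    (1 - u * v * q ^ a) * weightPoly q x u v (a + 1) b c =
      (x - v * q ^ (a + b + 1)) * weightPoly q x u v a b c +
        (q ^ d - x * u * q ^ a) * weightPoly q x u v a (b + 1) c := by
  induction b generalizing c d with
  | zero =>
    rcases c with _ | c
    · rw [weightPoly_succ_zero hq]
      simp only [weightPoly_zero hq, qBinom_zero_right hq, Nat.sub_zero]
      obtain rfl : d = a + 1 := by omega
      ring
    · rw [weightPoly_succ_succ hq]
      obtain rfl : a = c + d := by omega
      simp only [weightPoly_zero hq, qPoch_succ]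
      have hP := qBinom_succ_succ hq (c + d) c
      have hM := qBinom_mul_succ hq c d
      rcases d with _ | d
      · simp [qBinom_self hq, qBinom_of_lt q (Nat.lt_succ_self c)]
        ring
      · have e1 : c + (d + 1) + 1 - (c + 1) = d + 1 := by omega
        have e2 : c + (d + 1) - (c + 1) = d := by omega
        have e3 : c + (d + 1) - c = d + 1 := by omega
        rw [e1, e2, e3, hP]
        linear_combination (- qPoch q (u * x) c * x ^ (d + 1) * (1 - u * x * q ^ c)) * hM
  | succ b ih =>
    rcases d with _ | d
    · obtain rfl : c = a + b + 1 + 1 := by omega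
      have i2 := ih (c := a + b + 1) (d := 0) (by omega)
      rw [weightPoly_succ_succ hq, weightPoly_of_lt q x u v (by omega : a + 1 + b < a + b + 1 + 1),
        weightPoly_of_lt q x u v (by omega : a + (b + 1) < a + b + 1 + 1),
        weightPoly_succ_succ hq x u v a (b + 1),
        weightPoly_of_lt q x u v (by omega : a + (b + 1) < a + b + 1 + 1)]
      rw [weightPoly_of_lt q x u v (by omega : a + b < a + b + 1)] at i2
      linear_combination (1 - u * v * q ^ (a + b + 1)) * i2
    · have hp : q ^ c * q ^ d = q ^ a * q ^ (b + 1) := by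
        rw [← pow_add, ← pow_add, show c + d = a + (b + 1) by omega]
      have i1 := ih (c := c) (d := d) (by omega)
      rcases c with _ | c
      · rw [weightPoly_succ_zero hq, weightPoly_succ_zero hq x u v a (b + 1)]
        rw [weightPoly_succ_zero hq] at i1 ⊢
        linear_combination v * i1 - v ^ 2 * (q - 1) * weightPoly q x u v a b 0 * hp
      · have i2 := ih (c := c) (d := d + 1) (by omega)
        have r1 := weightPoly_succ_succ hq x u v a b c
        rw [weightPoly_succ_succ hq, weightPoly_succ_succ hq x u v a (b + 1)]
        linear_combination v * q ^ (c + 1) * i1 + (1 - u * v * q ^ c) * i2 -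
          (x - v * q ^ (a + b + 1)) * r1 -
          v * (q - 1) * weightPoly q x u v a (b + 1) (c + 1) * hp

/-- Compares adjacent top labels, which occur in `upperColumn` because the two values of the right
label shift the intermediate label by one. -/
theorem weightPoly_contiguous_top (hq : ∀ k : ℕ, q ^ (k + 1) ≠ 1) (x u v : 𝕜) {a b c d : ℕ}
    (h : a + b = c + d) :
    (1 - q ^ (c + 1)) * weightPoly q x u v a b (c + 1) =
      (1 - q ^ b) * weightPoly q x u v a (b - 1) c +
        q ^ b * (1 - q ^ a) * weightPoly q x u v (a - 1) b c -
        u * q ^ c * (1 - q ^ d) * weightPoly q x u v a b c := by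
  induction b generalizing c d with
  | zero =>
    obtain rfl : a = c + d := by omega
    simp only [weightPoly_zero hq]
    have hM := qBinom_mul_succ hq c d
    rcases d with _ | d
    · rcases c with _ | c
      · simp [qBinom_of_lt q (Nat.lt_succ_self 0)]
      · simp [qBinom_of_lt q (Nat.lt_succ_self c), qBinom_of_lt q (Nat.lt_succ_self (c + 1))]
    · have e1 : c + (d + 1) - (c + 1) = d := by omega
      have e2 : c + (d + 1) - 1 - c = d := by omega
      have e3 : c + (d + 1) - c = d + 1 := by omega
      have e4 : c + (d + 1) - 1 = c + d := by omega
      have hA := qBinom_add_mul hq c d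
      rw [← add_assoc] at hM ⊢
      rw [← add_assoc] at e1 e2 e3 e4
      rw [e1, e2, e3, e4, qPoch_succ]
      linear_combination qPoch q (u * x) c * (1 - u * x * q ^ c) * x ^ d * hM +
        qPoch q (u * x) c * x ^ d * hA
  | succ b ih =>
    have hr : ∀ c, (1 - q ^ b) * weightPoly q x u v a b (c + 1) =
        (1 - q ^ b) * (v * q ^ (c + 1) * weightPoly q x u v a (b - 1) (c + 1) +
          (1 - u * v * q ^ c) * weightPoly q x u v a (b - 1) c) := by
      intro c
      rcases b with _ | b
      · simp
      · rw [weightPoly_succ_succ hq, Nat.add_sub_cancel]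
    have hr0 : (1 - q ^ b) * weightPoly q x u v a b 0 =
        (1 - q ^ b) * (v * weightPoly q x u v a (b - 1) 0) := by
      rcases b with _ | b
      · simp
      · rw [weightPoly_succ_zero hq, Nat.add_sub_cancel]
    rw [Nat.add_sub_cancel]
    rcases d with _ | d
    · obtain rfl : c = a + b + 1 := by omega
      have i2 := ih (c := a + b) (d := 0) (by omega)
      have hr2 := hr (a + b)
      rw [weightPoly_succ_succ hq]
      rw [weightPoly_of_lt q x u v (by omega : a + b < a + b + 1)] at i2 hr2 ⊢
      rw [weightPoly_of_lt q x u v (by omega : a + b < a + b + 1 + 1)]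
      rcases a with _ | a
      · simp
      · rw [weightPoly_of_lt q x u v (by omega : a + 1 - 1 + (b + 1) < a + 1 + b + 1)]
        ring
    have i1 := ih (c := c) (d := d) (by omega)
    rcases c with _ | c
    · rw [weightPoly_succ_succ hq, weightPoly_succ_zero hq x u v a b,
        weightPoly_succ_zero hq x u v (a - 1) b]
      linear_combination v * q * i1 - q * hr0
    · have i2 := ih (c := c) (d := d + 1) (by omega)
      have hr2 := hr c
      rw [weightPoly_succ_succ hq, weightPoly_succ_succ hq x u v (a - 1) b,
        weightPoly_succ_succ hq x u v a b c]
      linear_combination v * q ^ (c + 1 + 1) * i1 + q * (1 - u * v * q ^ c) * i2 - q * hr2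

end Contiguous

/-! ### The exchange relation for one column -/

section Exchange

variable {𝕜 : Type*} [Field 𝕜] {q : 𝕜}

/-- The vertex weights `hlWeight q y v u` turned upside down and conjugated by the factors of
`cCoeff`, as a function of the bottom label, the left label and the right label. -/
def dualWeight (q y u v : 𝕜) : ℕ → ℕ → ℕ → 𝕜
  | a, 0, 0 => (1 + v * y * q ^ a) * (1 + v * y)⁻¹
  | a, 0, 1 => (1 - u * v * q ^ a) * y * (1 + v * y)⁻¹
  | a, 1, 0 => (1 - q ^ a) * (1 + v * y)⁻¹
  | a, 1, 1 => (y + u * q ^ a) * (1 + v * y)⁻¹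
  | _, _, _ => 0

/-- The weight of a column of two vertices, a `dualWeight` below a `weightPoly`, with bottom label
`a` and top label `c`. The labels of the lower vertex on the left and on the right are `s'` and `s`;
the upper vertex has left label `e + s' - f`. -/
def lowerColumn (q x y u v : 𝕜) (a c e f s' s : ℕ) : 𝕜 :=
  if f ≤ e + s' then dualWeight q y u v a s' s * weightPoly q x u v (a + s - s') (e + s' - f) c
  else 0

/-- The weight of a column of two vertices, a `weightPoly` below a `dualWeight`, with bottom label
`a` and top label `c`. The labels of the upper vertex on the left and on the right are `s'` and `s`;
the lower vertex has left label `e + s' - f`. -/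
def upperColumn (q x y u v : 𝕜) (a c e f s' s : ℕ) : 𝕜 :=
  if f ≤ e + s' ∧ s ≤ c + s' then
    weightPoly q x u v a (e + s' - f) (c + s' - s) * dualWeight q y u v (c + s' - s) s' s
  else 0

/-- The relation between the partition functions `F` and `F'` of the two stackings of two half-rows
that is preserved when a column is added; `e` and `f` are the sums of the bottom labels and
of the top labels over the columns to the left. -/
def Exchange (q z : 𝕜) (e f : ℕ) (F F' : ℕ → 𝕜) : Prop :=
  (f ≤ e → F 0 + z * F 1 = (1 + z) * F' 0) ∧
    (f ≤ e + 1 → (1 - q ^ (e + 1 - f)) * F 0 + (z + q ^ (e + 1 - f)) * F 1 = (1 + z) * F' 1)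

theorem lowerColumn_eq (q x y u v : 𝕜) {a c e f s' s g k : ℕ} (h : f + g = e + s')
    (hk : a + s - s' = k) : lowerColumn q x y u v a c e f s' s =
      dualWeight q y u v a s' s * weightPoly q x u v k g c := by
  have : e + s' - f = g := by omega
  rw [lowerColumn, if_pos (by omega), this, hk]

theorem upperColumn_eq (q x y u v : 𝕜) {a c e f s' s g k : ℕ} (h : f + g = e + s')
    (hk : s + k = c + s') : upperColumn q x y u v a c e f s' s =
      weightPoly q x u v a g k * dualWeight q y u v k s' s := by
  have h1 : e + s' - f = g := by omega
  have h2 : c + s' - s = k := by omega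
  rw [upperColumn, if_pos (by omega), h1, h2]

theorem lowerColumn_of_lt (q x y u v : 𝕜) {a c e f s' s : ℕ} (h : e + a + s < f + c) :
    lowerColumn q x y u v a c e f s' s = 0 := by
  rw [lowerColumn]
  split_ifs with hf
  · rcases Nat.lt_or_ge (a + s) s' with h1 | h1
    · rcases s' with _ | _ | s'
      · omega
      -- Conservation would require the intermediate label -1, which natural subtraction hides; the
      -- factor `1 - q ^ 0` of the dual weight kills this case.
      · obtain rfl : a = 0 := by omega
        obtain rfl : s = 0 := by omega
        simp [dualWeight]
      · simp [dualWeight]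
    · rw [weightPoly_of_lt _ _ _ _ (by omega), mul_zero]
  · rfl

theorem upperColumn_of_lt (q x y u v : 𝕜) {a c e f s' s : ℕ} (h : e + a + s < f + c) :
    upperColumn q x y u v a c e f s' s = 0 := by
  rw [upperColumn]
  split_ifs with hf
  · rw [weightPoly_of_lt _ _ _ _ (by omega), zero_mul]
  · rfl

/-- The terms in `F 0` and `F 1` are handled separately: contiguous relations reduce every upper
vertex to the left label `p` with bottom label `a`, after which the two assumed relations convert
`F` into `F'`. -/
theorem Exchange.step_fst (hq : ∀ k : ℕ, q ^ (k + 1) ≠ 1) (x y u v : 𝕜) {a c e f : ℕ}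
    {F F' : ℕ → 𝕜} (h : Exchange q (x * y) (e + a) (f + c) F F') (hef : f ≤ e) :
    ∑ s ∈ Finset.range 2, lowerColumn q x y u v a c e f 0 s * F s +
      x * y * ∑ s ∈ Finset.range 2, lowerColumn q x y u v a c e f 1 s * F s =
    (1 + x * y) * ∑ s ∈ Finset.range 2, upperColumn q x y u v a c e f 0 s * F' s := by
  simp only [Finset.sum_range_succ, Finset.sum_range_zero, zero_add]
  rcases lt_or_ge (e + a + 1) (f + c) with hlt | hge
  · simp [lowerColumn_of_lt q x y u v hlt, upperColumn_of_lt q x y u v hlt,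
      lowerColumn_of_lt q x y u v (by omega : e + a + 0 < f + c),
      upperColumn_of_lt q x y u v (by omega : e + a + 0 < f + c)]
  obtain ⟨h0, h1⟩ := h
  obtain ⟨p, rfl⟩ := Nat.exists_eq_add_of_le hef
  obtain ⟨r, hr⟩ := Nat.exists_eq_add_of_le hge
  have er : f + p + a + 1 - (f + c) = r := by omega
  have hI := h1 (by omega)
  rw [er] at hI
  -- The first relation is available only for `f + c ≤ e + a`; in the one remaining case, `r = 0`,
  -- the weight in front vanishes.
  have hA : weightPoly q x u v a p c * (F 0 + x * y * F 1) =
      weightPoly q x u v a p c * ((1 + x * y) * F' 0) := by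
    rcases r with _ | r
    · rw [weightPoly_of_lt q x u v (by omega : a + p < c)]
      ring
    · rw [h0 (by omega)]
  have C1 := weightPoly_contiguous_sub hq x u v (by omega : a + (p + 1) = c + r)
  have C2 := weightPoly_contiguous_add hq x u v (by omega : a + p + 1 = c + r)
  have hp : q ^ c * q ^ r = q ^ a * q ^ (p + 1) := by
    rw [← pow_add, ← pow_add, show c + r = a + (p + 1) by omega]
  rw [Nat.add_sub_cancel] at C1
  rw [lowerColumn_eq q x y u v (g := p) (k := a) (by omega) (by omega),
    lowerColumn_eq q x y u v (g := p) (k := a + 1) (by omega) (by omega),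
    lowerColumn_eq q x y u v (g := p + 1) (k := a - 1) (by omega) (by omega),
    lowerColumn_eq q x y u v (g := p + 1) (k := a) (by omega) (by omega),
    upperColumn_eq q x y u v (g := p) (k := c) (by omega) (by omega)]
  rcases c with _ | c
  · have r1 := weightPoly_succ_zero hq x u v a p
    have hz : upperColumn q x y u v a 0 (f + p) f 0 1 = 0 := by simp [upperColumn]
    rw [hz]
    simp only [dualWeight]
    generalize (1 + v * y)⁻¹ = D
    linear_combination (1 + v * y) * D * hA - y * D * F 0 * C1 + y * D * F 1 * C2 +
      y * D * ((1 - q ^ r) * F 0 + (x * y + q ^ r) * F 1) * r1 +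
      v * y * D * weightPoly q x u v a p 0 * (F 1 - F 0) * hp
  · have r1 := weightPoly_succ_succ hq x u v a p c
    rw [upperColumn_eq q x y u v (g := p) (k := c) (by omega) (by omega)]
    simp only [dualWeight]
    generalize (1 + v * y)⁻¹ = D
    linear_combination (1 + v * y * q ^ (c + 1)) * D * hA - y * D * F 0 * C1 + y * D * F 1 * C2 +
      y * D * ((1 - q ^ r) * F 0 + (x * y + q ^ r) * F 1) * r1 +
      (1 - u * v * q ^ c) * y * D * weightPoly q x u v a p c * hI +
      v * y * D * weightPoly q x u v a p (c + 1) * (F 1 - F 0) * hp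

theorem Exchange.step_snd (hq : ∀ k : ℕ, q ^ (k + 1) ≠ 1) (x y u v : 𝕜) {a c e f : ℕ}
    {F F' : ℕ → 𝕜} (h : Exchange q (x * y) (e + a) (f + c) F F') (hef : f ≤ e + 1) :
    (1 - q ^ (e + 1 - f)) * ∑ s ∈ Finset.range 2, lowerColumn q x y u v a c e f 0 s * F s +
      (x * y + q ^ (e + 1 - f)) * ∑ s ∈ Finset.range 2, lowerColumn q x y u v a c e f 1 s * F s =
    (1 + x * y) * ∑ s ∈ Finset.range 2, upperColumn q x y u v a c e f 1 s * F' s := by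
  simp only [Finset.sum_range_succ, Finset.sum_range_zero, zero_add]
  rcases lt_or_ge (e + a + 1) (f + c) with hlt | hge
  · simp [lowerColumn_of_lt q x y u v hlt, upperColumn_of_lt q x y u v hlt,
      lowerColumn_of_lt q x y u v (by omega : e + a + 0 < f + c),
      upperColumn_of_lt q x y u v (by omega : e + a + 0 < f + c)]
  obtain ⟨h0, h1⟩ := h
  obtain ⟨p, hp'⟩ := Nat.exists_eq_add_of_le hef
  obtain ⟨r, hr⟩ := Nat.exists_eq_add_of_le hge
  have er : e + a + 1 - (f + c) = r := by omega
  have ep : e + 1 - f = p := by omega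
  have hI := h1 (by omega)
  rw [er] at hI
  rw [ep]
  have hA : weightPoly q x u v a p (c + 1) * (F 0 + x * y * F 1) =
      weightPoly q x u v a p (c + 1) * ((1 + x * y) * F' 0) := by
    rcases r with _ | r
    · rw [weightPoly_of_lt q x u v (by omega : a + p < c + 1)]
      ring
    · rw [h0 (by omega)]
  have C1 := weightPoly_contiguous_sub hq x u v (by omega : a + p = c + r)
  have C3 := weightPoly_contiguous_top hq x u v (by omega : a + p = c + r)
  have C2 : (1 - q ^ p) * ((1 - u * v * q ^ a) * weightPoly q x u v (a + 1) (p - 1) c) =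
      (1 - q ^ p) * ((x - v * q ^ (a + p)) * weightPoly q x u v a (p - 1) c +
        (q ^ r - x * u * q ^ a) * weightPoly q x u v a p c) := by
    rcases p with _ | p
    · simp
    · rw [Nat.add_sub_cancel, weightPoly_contiguous_add hq x u v (by omega : a + p + 1 = c + r),
        add_assoc]
  have hp : q ^ c * q ^ r = q ^ a * q ^ p := by
    rw [← pow_add, ← pow_add, show c + r = a + p by omega]
  -- At `p = 0` the left label of the upper vertex would be -1, but the coefficient `1 - q ^ p` is
  -- zero.
  have hl : ∀ s, (1 - q ^ p) * lowerColumn q x y u v a c e f 0 s =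
      (1 - q ^ p) * (dualWeight q y u v a 0 s * weightPoly q x u v (a + s) (p - 1) c) := by
    intro s
    rcases p with _ | p
    · simp
    · rw [lowerColumn_eq q x y u v (g := p) (k := a + s) (by omega) (by omega), Nat.add_sub_cancel]
  have l0 := hl 0
  have l1 := hl 1
  rw [lowerColumn_eq q x y u v (g := p) (k := a - 1) (s' := 1) (by omega) (by omega),
    lowerColumn_eq q x y u v (g := p) (k := a) (s' := 1) (by omega) (by omega),
    upperColumn_eq q x y u v (g := p) (k := c + 1) (by omega) (by omega),
    upperColumn_eq q x y u v (g := p) (k := c) (by omega) (by omega)]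
  simp only [dualWeight, add_zero] at l0 l1 ⊢
  generalize (1 + v * y)⁻¹ = D at l0 l1 ⊢
  linear_combination F 0 * l0 + F 1 * l1 + (1 - q ^ (c + 1)) * D * hA +
    weightPoly q x u v a p c * (y + u * q ^ c) * D * hI - D * F 0 * C3 - y * D * F 0 * C1 +
    y * D * F 1 * C2 - x * y * D * F 1 * C3 + y * D * F 1 * q ^ p * C1 -
    u * D * weightPoly q x u v a p c * F 1 * (1 + x * y) * hp

theorem Exchange.step (hq : ∀ k : ℕ, q ^ (k + 1) ≠ 1) (x y u v : 𝕜) {a c e f : ℕ}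
    {F F' : ℕ → 𝕜} (h : Exchange q (x * y) (e + a) (f + c) F F') :
    Exchange q (x * y) e f
      (fun s' => ∑ s ∈ Finset.range 2, lowerColumn q x y u v a c e f s' s * F s)
      (fun s' => ∑ s ∈ Finset.range 2, upperColumn q x y u v a c e f s' s * F' s) :=
  ⟨h.step_fst hq x y u v, h.step_snd hq x y u v⟩

end Exchange

/-! ### Tails of label sequences -/

section Tails

/-- The sum of the labels in the columns `k, k + 1, …`. -/
def tail (a : ℕ →₀ ℕ) (k : ℕ) : ℕ := a.sum fun j n => if k ≤ j then n else 0

theorem tail_succ (a : ℕ →₀ ℕ) (k : ℕ) : tail a k = a k + tail a (k + 1) := by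
  have h : a k = a.sum fun j n => if j = k then n else 0 := by
    rw [Finsupp.sum, Finset.sum_ite_eq']
    split_ifs with hk
    · rfl
    · exact Finsupp.notMem_support_iff.mp hk
  rw [h, tail, tail, Finsupp.sum, Finsupp.sum, Finsupp.sum, ← Finset.sum_add_distrib]
  refine Finset.sum_congr rfl fun j _ => ?_
  split_ifs <;> omega

theorem tail_antitone (a : ℕ →₀ ℕ) : Antitone (tail a) :=
  antitone_nat_of_succ_le fun k => by rw [tail_succ a k]; omega

theorem apply_le_tail (a : ℕ →₀ ℕ) (k : ℕ) : a k ≤ tail a k := by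
  rw [tail_succ]; omega

theorem tail_eq_zero_of_le {a : ℕ →₀ ℕ} {N k : ℕ} (h : tail a N = 0) (hk : N ≤ k) :
    tail a k = 0 :=
  Nat.le_zero.mp (h ▸ tail_antitone a hk)

theorem apply_eq_zero_of_tail {a : ℕ →₀ ℕ} {N k : ℕ} (h : tail a N = 0) (hk : N ≤ k) : a k = 0 :=
  Nat.le_zero.mp (tail_eq_zero_of_le h hk ▸ apply_le_tail a k)

theorem tail_eq_zero_iff {a : ℕ →₀ ℕ} {N : ℕ} : tail a N = 0 ↔ ∀ k, N ≤ k → a k = 0 := by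
  refine ⟨fun h k hk => apply_eq_zero_of_tail h hk, fun h => Finset.sum_eq_zero fun j _ => ?_⟩
  simp only
  split_ifs with hj
  · exact h j hj
  · rfl

theorem exists_apply_eq_zero (a : ℕ →₀ ℕ) : ∃ N, ∀ k, N ≤ k → a k = 0 := by
  obtain ⟨N, hN⟩ := a.support.bddAbove
  refine ⟨N + 1, fun k hk => ?_⟩
  by_contra h
  have := hN (Finset.mem_coe.mpr (Finsupp.mem_support_iff.mpr h))
  omega

theorem exists_tail_eq_zero (a : ℕ →₀ ℕ) : ∃ N, tail a N = 0 := by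
  simp_rw [tail_eq_zero_iff]
  exact exists_apply_eq_zero a

theorem tail_injective : Function.Injective tail := fun a b h => by
  ext k
  have h1 := tail_succ a k
  have h2 := tail_succ b k
  rw [h] at h1
  omega

/-- Induction from the far left, where all labels vanish, towards the right boundary. -/
theorem of_succ {P : ℕ → Prop} {N : ℕ} (h0 : ∀ k, N ≤ k → P k) (h : ∀ k, P (k + 1) → P k)
    (k : ℕ) : P k := by
  have : ∀ d k, N ≤ k + d → P k := by
    intro d
    induction d with
    | zero => exact fun k hk => h0 k hk
    | succ d ih => exact fun k hk => h k (ih (k + 1) (by omega))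
  exact this N k (Nat.le_add_left N k)

/-- Label sequences are the successive differences of decreasing, eventually zero sequences; this
rebuilds an intermediate state from a path of horizontal labels. -/
theorem exists_tail_eq {f : ℕ → ℕ} (hf : Antitone f) {N : ℕ} (hN : f N = 0) :
    ∃ a : ℕ →₀ ℕ, tail a = f := by
  have hz : ∀ k, N ≤ k → f k = 0 := fun k hk => Nat.le_zero.mp (hN ▸ hf hk)
  refine ⟨Finsupp.onFinset (Finset.range N) (fun k => f k - f (k + 1)) fun k hk => ?_, ?_⟩
  · by_contra h
    rw [Finset.mem_range, not_lt] at h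
    exact hk (by rw [hz k h, Nat.zero_sub])
  · set a := Finsupp.onFinset (Finset.range N) (fun k => f k - f (k + 1)) _
    have ha : ∀ k, a k = f k - f (k + 1) := fun k => rfl
    have h0 : tail a N = 0 := tail_eq_zero_iff.mpr fun k hk => by rw [ha, hz k hk, Nat.zero_sub]
    funext k
    refine of_succ (P := fun k => tail a k = f k) (N := N) (fun k hk => by rw [hz k hk, tail_eq_zero_of_le h0 hk])
      (fun k hk => ?_) k
    rw [tail_succ, hk, ha]
    have := hf (Nat.le_succ k)
    simp only [Nat.succ_eq_add_one] at this
    omega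

/-- The label sequences supported on the first `N` columns with labels less than `N`. -/
def box (N : ℕ) : Finset (ℕ →₀ ℕ) := (Finset.range N).finsupp fun _ => Finset.range N

theorem tail_of_mem_box {a : ℕ →₀ ℕ} {N : ℕ} (h : a ∈ box N) : tail a N = 0 := by
  rw [box, Finset.mem_finsupp_iff] at h
  refine tail_eq_zero_iff.mpr fun k hk => ?_
  by_contra hk'
  have := Finset.mem_range.mp (h.1 (Finsupp.mem_support_iff.mpr hk'))
  omega

theorem mem_box {a : ℕ →₀ ℕ} {N : ℕ} (h : tail a N = 0) (h' : tail a 0 < N) : a ∈ box N := by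
  rw [box, Finset.mem_finsupp_iff]
  refine ⟨fun k hk => ?_, fun k _ => ?_⟩
  · rw [Finset.mem_range]
    by_contra hk'
    exact Finsupp.mem_support_iff.mp hk (apply_eq_zero_of_tail h (not_lt.mp hk'))
  · rw [Finset.mem_range]
    exact ((apply_le_tail a k).trans (tail_antitone a (Nat.zero_le k))).trans_lt h'

theorem mem_box_of_le {a : ℕ →₀ ℕ} {N N' : ℕ} (h : a ∈ box N) (hN : N ≤ N') : a ∈ box N' := by
  rw [box, Finset.mem_finsupp_iff] at h ⊢
  refine ⟨h.1.trans (Finset.range_subset_range.mpr hN), fun k hk => ?_⟩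
  rw [Finset.mem_range]
  rcases lt_or_ge k N with hk' | hk'
  · exact (Finset.mem_range.mp (h.2 k (Finset.mem_range.mpr hk'))).trans_le hN
  · have : a k = 0 := by
      by_contra h0
      have := Finset.mem_range.mp (h.1 (Finsupp.mem_support_iff.mpr h0))
      omega
    rw [this]
    exact (Nat.zero_le k).trans_lt (Finset.mem_range.mp hk)

theorem exists_mem_box (a : ℕ →₀ ℕ) : ∃ N, a ∈ box N := by
  obtain ⟨N, hN⟩ := exists_tail_eq_zero a
  exact ⟨max N (tail a 0 + 1), mem_box (tail_eq_zero_of_le hN (le_max_left _ _)) (by omega)⟩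

/-- Unconditional sums over states can thus be computed as limits over boxes, which are compatible
with cutting the lattice after finitely many columns. -/
theorem tendsto_box : Tendsto box atTop atTop :=
  tendsto_atTop_finset_of_monotone (fun _ _ h _ ha => mem_box_of_le ha h) exists_mem_box

theorem finite_tail_le (a : ℕ →₀ ℕ) : {b : ℕ →₀ ℕ | ∀ k, tail b k ≤ tail a k}.Finite := by
  obtain ⟨N, hN⟩ := exists_tail_eq_zero a
  refine (box (max N (tail a 0 + 1))).finite_toSet.subset fun b hb => ?_
  have h1 := hb (max N (tail a 0 + 1))
  rw [tail_eq_zero_of_le hN (le_max_left _ _)] at h1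
  have := hb 0
  exact mem_box (Nat.le_zero.mp h1) (by omega)

end Tails

/-! ### The partition function of one row -/

section Row

variable {𝕜 : Type*} [Field 𝕜]

/-- Conservation is summed over all columns from the far left up to `k`, so the horizontal label is
the difference of the two tails. -/
theorem add_tail_of_finprod_ne_zero {w : ℕ → ℕ → ℕ → ℕ → ℕ → 𝕜}
    (hw : ∀ k a b c d, w k a b c d ≠ 0 → a + b = c + d) (hw1 : ∀ k, w k 0 0 0 0 = 1)
    (a c h : ℕ →₀ ℕ) (hne : ∏ᶠ k, w k (a k) (h (k + 1)) (c k) (h k) ≠ 0) (k : ℕ) :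
    h k + tail c k = tail a k := by
  obtain ⟨K, hK⟩ := exists_apply_eq_zero h
  obtain ⟨A, hA⟩ := exists_tail_eq_zero a
  obtain ⟨C, hC⟩ := exists_tail_eq_zero c
  have hN : ∀ k, max K (max A C) ≤ k → h k = 0 ∧ h (k + 1) = 0 ∧ a k = 0 ∧ c k = 0 := by
    intro k hk
    exact ⟨hK k (by omega), hK (k + 1) (by omega), apply_eq_zero_of_tail hA (by omega),
      apply_eq_zero_of_tail hC (by omega)⟩
  have hsub : Function.mulSupport (fun k => w k (a k) (h (k + 1)) (c k) (h k)) ⊆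
      ↑(Finset.range (max K (max A C))) := by
    intro k hk
    rw [Finset.coe_range, Set.mem_Iio]
    by_contra hk'
    obtain ⟨h1, h2, h3, h4⟩ := hN k (not_lt.mp hk')
    refine hk ?_
    simp only
    rw [h1, h2, h3, h4, hw1]
  rw [finprod_eq_prod_of_mulSupport_subset _ hsub, Finset.prod_ne_zero_iff] at hne
  refine of_succ (P := fun k => h k + tail c k = tail a k) (N := max K (max A C)) (fun k hk => ?_)
    (fun k hk => ?_) k
  · rw [(hN k hk).1, tail_eq_zero_of_le hA (by omega), tail_eq_zero_of_le hC (by omega)]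
  · rw [tail_succ c k, tail_succ a k, ← hk]
    rcases lt_or_ge k (max K (max A C)) with h1 | h1
    · have := hw _ _ _ _ _ (hne k (Finset.mem_range.mpr h1))
      omega
    · obtain ⟨h1, h2, h3, h4⟩ := hN k h1
      rw [h1, h2, h3, h4]

theorem tail_le_of_rowZ_ne_zero {w : ℕ → ℕ → ℕ → ℕ → ℕ → 𝕜}
    (hw : ∀ k a b c d, w k a b c d ≠ 0 → a + b = c + d) (hw1 : ∀ k, w k 0 0 0 0 = 1)
    {a c : ℕ →₀ ℕ} (h : rowZ w a c ≠ 0) (k : ℕ) : tail c k ≤ tail a k := by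
  by_contra hk
  refine h (finsum_eq_zero_of_forall_eq_zero fun h' => ?_)
  by_contra h0
  exact hk (by rw [← add_tail_of_finprod_ne_zero hw hw1 a c h' h0 k]; omega)

/-- Conservation leaves one candidate path. If the tails are not ordered, the truncated differences
still define a path, whose weight is zero, so no containment has to be assumed. -/
theorem rowZ_eq_prod {w : ℕ → ℕ → ℕ → ℕ → ℕ → 𝕜}
    (hw : ∀ k a b c d, w k a b c d ≠ 0 → a + b = c + d) (hw1 : ∀ k, w k 0 0 0 0 = 1)
    {a c : ℕ →₀ ℕ} {N : ℕ} (ha : tail a N = 0) (hc : tail c N = 0) :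
    rowZ w a c = ∏ k ∈ Finset.range N,
        w k (a k) (tail a (k + 1) - tail c (k + 1)) (c k) (tail a k - tail c k) := by
  have hfin : ∀ k, N ≤ k → tail a k - tail c k = 0 := fun k hk => by
    rw [tail_eq_zero_of_le ha hk, Nat.zero_sub]
  let h : ℕ →₀ ℕ := Finsupp.onFinset (Finset.range N) (fun k => tail a k - tail c k)
    fun k hk => by
      by_contra h
      exact hk (hfin k (not_lt.mp (mt Finset.mem_range.mpr h)))
  have hh : ∀ k, h k = tail a k - tail c k := fun k => rfl
  rw [rowZ, finsum_eq_single _ h, finprod_eq_prod_of_mulSupport_subset (s := Finset.range N)]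
  · rfl
  · intro k hk
    rw [Finset.coe_range, Set.mem_Iio]
    by_contra hk'
    rw [not_lt] at hk'
    refine hk ?_
    simp only
    rw [hh, hh, hfin k hk', hfin (k + 1) (by omega), apply_eq_zero_of_tail ha hk',
      apply_eq_zero_of_tail hc hk', hw1]
  · intro h' hne
    by_contra h0
    refine hne (Finsupp.ext fun k => ?_)
    rw [hh, ← add_tail_of_finprod_ne_zero hw hw1 a c h' h0 k]
    omega

end Row

/-! ### Sums over paths of horizontal labels -/

section Paths

/-- The sum over all paths of labels less than `D` on the vertical edges to the right of columns
`0, …, N - 1`, the label to the left of column `N - 1` being given; `t k s' s` is the weight of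
column `k` with left label `s'` and right label `s`. -/
def pathSum {R : Type*} [CommSemiring R] (t : ℕ → ℕ → ℕ → R) (D : ℕ) : ℕ → ℕ → R
  | 0, _ => 1
  | N + 1, s' => ∑ s ∈ Finset.range D, t N s' s * pathSum t D N s

/-- A path extended to the left by the constant label `s`. -/
def extendPath {N : ℕ} (h : Fin N → ℕ) (s k : ℕ) : ℕ := if hk : k < N then h ⟨k, hk⟩ else s

theorem extendPath_of_lt {N : ℕ} (h : Fin N → ℕ) (s : ℕ) {k : ℕ} (hk : k < N) :
    extendPath h s k = h ⟨k, hk⟩ := dif_pos hk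

theorem extendPath_of_le {N : ℕ} (h : Fin N → ℕ) (s : ℕ) {k : ℕ} (hk : N ≤ k) :
    extendPath h s k = s := dif_neg (not_lt.mpr hk)

theorem extendPath_snoc {N : ℕ} (h : Fin N → ℕ) (s s' : ℕ) {k : ℕ} (hk : k ≤ N) :
    extendPath (Fin.snoc h s : Fin (N + 1) → ℕ) s' k = extendPath h s k := by
  rw [extendPath_of_lt _ _ (Nat.lt_succ_of_le hk)]
  rcases hk.lt_or_eq with hk | rfl
  · rw [extendPath_of_lt _ _ hk]
    exact Fin.snoc_castSucc (α := fun _ => ℕ) s h ⟨k, hk⟩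
  · rw [extendPath_of_le _ _ le_rfl]
    exact Fin.snoc_last (α := fun _ => ℕ) s h

theorem pathSum_eq_sum {R : Type*} [CommSemiring R] (t : ℕ → ℕ → ℕ → R) (D N s : ℕ) :
    pathSum t D N s = ∑ h ∈ Fintype.piFinset fun _ : Fin N => Finset.range D,
      ∏ k ∈ Finset.range N, t k (extendPath h s (k + 1)) (extendPath h s k) := by
  induction N generalizing s with
  | zero => simp [pathSum]
  | succ N ih =>
    rw [pathSum]
    simp_rw [ih, Finset.mul_sum]
    rw [← Finset.sum_product']
    refine Finset.sum_nbij' (fun p => Fin.snoc p.2 p.1) (fun h => (h (Fin.last N), Fin.init h))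
      ?_ ?_ ?_ ?_ ?_
    · rintro ⟨r, h⟩ hp
      rw [Finset.mem_product, Fintype.mem_piFinset] at hp
      rw [Fintype.mem_piFinset]
      refine Fin.lastCases ?_ fun i => ?_
      · simpa using hp.1
      · simpa using hp.2 i
    · intro h hh
      rw [Fintype.mem_piFinset] at hh
      rw [Finset.mem_product, Fintype.mem_piFinset]
      exact ⟨hh _, fun i => hh _⟩
    · rintro ⟨r, h⟩ -
      simp
    · intro h _
      simp
    · rintro ⟨r, h⟩ -
      simp only
      rw [Finset.prod_range_succ, extendPath_of_le _ s le_rfl, extendPath_snoc h r s le_rfl,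
        extendPath_of_le h r le_rfl, mul_comm]
      congr 1
      refine Finset.prod_congr rfl fun k hk => ?_
      rw [Finset.mem_range] at hk
      rw [extendPath_snoc h r s hk, extendPath_snoc h r s hk.le]

theorem extendPath_restrict {f : ℕ → ℕ} {N k : ℕ} (hk : k ≤ N) :
    extendPath (fun i : Fin N => f i) (f N) k = f k := by
  rcases hk.lt_or_eq with hk | rfl
  · rw [extendPath_of_lt _ _ hk]
  · rw [extendPath_of_le _ _ le_rfl]

theorem prod_extendPath_restrict {R : Type*} [CommSemiring R] (t : ℕ → ℕ → ℕ → R) (f : ℕ → ℕ)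
    {N s : ℕ} (hs : f N = s) :
    ∏ k ∈ Finset.range N, t k (extendPath (fun i : Fin N => f i) s (k + 1))
      (extendPath (fun i : Fin N => f i) s k) = ∏ k ∈ Finset.range N, t k (f (k + 1)) (f k) := by
  subst hs
  refine Finset.prod_congr rfl fun k hk => ?_
  rw [Finset.mem_range] at hk
  rw [extendPath_restrict hk, extendPath_restrict hk.le]

/-- States and paths need to correspond only where the weights are non-zero; degenerate paths that
come from no state are allowed. -/
theorem sum_eq_pathSum {R α : Type*} [CommSemiring R] (t : ℕ → ℕ → ℕ → R) (D N : ℕ) (s : Finset α)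
    (f : α → R) (lab : α → ℕ → ℕ)
    (hlab : ∀ a ∈ s, f a ≠ 0 → (∀ k < N, lab a k < D) ∧ lab a N = 0 ∧
      f a = ∏ k ∈ Finset.range N, t k (lab a (k + 1)) (lab a k))
    (hinj : ∀ a ∈ s, ∀ b ∈ s, f a ≠ 0 → f b ≠ 0 → (∀ k < N, lab a k = lab b k) → a = b)
    (hsurj : ∀ h : ℕ → ℕ, (∀ k, N ≤ k → h k = 0) → (∀ k < N, h k < D) →
      ∏ k ∈ Finset.range N, t k (h (k + 1)) (h k) ≠ 0 →
      ∃ a ∈ s, (∀ k < N, lab a k = h k) ∧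
        f a = ∏ k ∈ Finset.range N, t k (h (k + 1)) (h k)) :
    ∑ a ∈ s, f a = pathSum t D N 0 := by
  rw [pathSum_eq_sum]
  refine Finset.sum_bij_ne_zero (fun a _ _ i => lab a i) ?_ ?_ ?_ ?_
  · intro a ha hf
    rw [Fintype.mem_piFinset]
    exact fun i => Finset.mem_range.mpr ((hlab a ha hf).1 i i.2)
  · intro a ha hfa b hb hfb h
    exact hinj a ha b hb hfa hfb fun k hk => congrFun h ⟨k, hk⟩
  · intro h hh hne
    rw [Fintype.mem_piFinset] at hh
    obtain ⟨a, ha, hl, hf⟩ := hsurj (extendPath h 0) (fun k hk => extendPath_of_le h 0 hk)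
      (fun k hk => by rw [extendPath_of_lt h 0 hk]; exact Finset.mem_range.mp (hh _)) hne
    refine ⟨a, ha, by rwa [hf], funext fun i => ?_⟩
    rw [hl i i.2, extendPath_of_lt h 0 i.2]
  · intro a ha hf
    rw [prod_extendPath_restrict t (lab a) (hlab a ha hf).2.1]
    exact (hlab a ha hf).2.2

/-- For an upper bound, injectivity and non-negativity suffice: paths that come from no state only
enlarge the right side. -/
theorem sum_le_pathSum {α : Type*} (t : ℕ → ℕ → ℕ → ℝ) (ht : ∀ k s' s, 0 ≤ t k s' s)
    (D N : ℕ) (s : Finset α) (f : α → ℝ) (lab : α → ℕ → ℕ)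
    (hlab : ∀ a ∈ s, f a ≠ 0 → (∀ k < N, lab a k < D) ∧ lab a N = 0 ∧
      f a ≤ ∏ k ∈ Finset.range N, t k (lab a (k + 1)) (lab a k))
    (hinj : ∀ a ∈ s, ∀ b ∈ s, f a ≠ 0 → f b ≠ 0 → (∀ k < N, lab a k = lab b k) → a = b) :
    ∑ a ∈ s, f a ≤ pathSum t D N 0 := by
  classical
  rw [pathSum_eq_sum, ← Finset.sum_filter_ne_zero]
  set g : (Fin N → ℕ) → ℝ := fun h =>
    ∏ k ∈ Finset.range N, t k (extendPath h 0 (k + 1)) (extendPath h 0 k)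
  calc ∑ a ∈ s with f a ≠ 0, f a
      ≤ ∑ a ∈ s with f a ≠ 0, g fun i => lab a i := by
        refine Finset.sum_le_sum fun a ha => ?_
        rw [Finset.mem_filter] at ha
        obtain ⟨-, h2, h3⟩ := hlab a ha.1 ha.2
        exact h3.trans_eq (prod_extendPath_restrict t (lab a) h2).symm
    _ = ∑ h ∈ (s.filter fun a => f a ≠ 0).image fun a (i : Fin N) => lab a i, g h := by
        rw [Finset.sum_image]
        intro a ha b hb h
        rw [Finset.mem_coe, Finset.mem_filter] at ha hb
        exact hinj a ha.1 b hb.1 ha.2 hb.2 fun k hk => congrFun h ⟨k, hk⟩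
    _ ≤ _ := by
        refine Finset.sum_le_sum_of_subset_of_nonneg (fun h hh => ?_) fun h _ _ =>
          Finset.prod_nonneg fun k _ => ht _ _ _
        obtain ⟨a, ha, rfl⟩ := Finset.mem_image.mp hh
        rw [Finset.mem_filter] at ha
        rw [Fintype.mem_piFinset]
        exact fun i => Finset.mem_range.mpr ((hlab a ha.1 ha.2).1 i i.2)

end Paths

/-! ### Infinite matrices with controlled growth -/

section Kernel

open scoped ENNReal

variable {S : Type*}

/-- A class of growth functions: a down-closed set of finite functions that contains the indicator
functions of points. -/
structure IsGrowthClass (Good : (S → ℝ≥0∞) → Prop) : Prop where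
  mono : ∀ {f g : S → ℝ≥0∞}, f ≤ g → Good g → Good f
  ne_top : ∀ {g : S → ℝ≥0∞}, Good g → ∀ a, g a ≠ ⊤
  single : ∀ a : S, Good (Set.indicator {a} 1)

variable {𝕜 : Type*} [NormedField 𝕜]

/-- An infinite matrix whose matrix of absolute values preserves a class of growth functions. -/
def Preserves (Good : (S → ℝ≥0∞) → Prop) (K : S → S → 𝕜) : Prop :=
  ∀ g, Good g → Good fun a => ∑' b, ‖K a b‖ₑ * g b

/-- The product of infinite matrices. -/
def kmul (K K' : S → S → 𝕜) (a c : S) : 𝕜 := ∑' b, K a b * K' b c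

open scoped Classical in
/-- The infinite identity matrix. -/
def kone (a b : S) : 𝕜 := if a = b then 1 else 0

variable {Good : (S → ℝ≥0∞) → Prop} {K K' K'' : S → S → 𝕜}

/-- A column is dominated by the image of the indicator function of one point. -/
theorem Preserves.col (hG : IsGrowthClass Good) (h : Preserves Good K) (c : S) :
    Good fun a => ‖K a c‖ₑ := by
  refine hG.mono (fun a => ?_) (h _ (hG.single c))
  refine le_trans ?_ (ENNReal.le_tsum c)
  simp

theorem Preserves.tsum_ne_top (hG : IsGrowthClass Good) (h : Preserves Good K)
    (h' : Preserves Good K') (a c : S) : ∑' b, ‖K a b * K' b c‖ₑ ≠ ⊤ := by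
  simp_rw [enorm_mul]
  exact hG.ne_top (h _ (h'.col hG c)) a

theorem kmul_kone (K : S → S → 𝕜) : kmul K kone = K := by
  funext a c
  rw [kmul, tsum_eq_single c]
  · simp [kone]
  · intro b hb
    simp [kone, hb]

theorem kone_kmul (K : S → S → 𝕜) : kmul kone K = K := by
  funext a c
  rw [kmul, tsum_eq_single a]
  · simp [kone]
  · intro b hb
    simp [kone, hb.symm]

theorem smul_kmul (r : 𝕜) (K K' : S → S → 𝕜) : kmul (r • K) K' = r • kmul K K' := by
  funext a c
  simp only [kmul, Pi.smul_apply, smul_eq_mul, mul_assoc, tsum_mul_left]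

theorem kmul_smul (r : 𝕜) (K K' : S → S → 𝕜) : kmul K (r • K') = r • kmul K K' := by
  funext a c
  simp only [kmul, Pi.smul_apply, smul_eq_mul, mul_left_comm _ r, tsum_mul_left]

theorem Preserves.kone (hG : IsGrowthClass Good) :
    Preserves Good (kone : S → S → 𝕜) := by
  intro g hg
  refine hG.mono (fun a => le_of_eq ?_) hg
  rw [tsum_eq_single a]
  · simp [LatticeCauchy.kone]
  · intro b hb
    simp [LatticeCauchy.kone, hb.symm]

theorem Preserves.kmul (hG : IsGrowthClass Good) (h : Preserves Good K)
    (h' : Preserves Good K') : Preserves Good (kmul K K') := by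
  intro g hg
  refine hG.mono (fun a => ?_) (h _ (h' g hg))
  calc ∑' c, ‖LatticeCauchy.kmul K K' a c‖ₑ * g c
      ≤ ∑' c, (∑' b, ‖K a b‖ₑ * ‖K' b c‖ₑ) * g c := by
        refine ENNReal.tsum_le_tsum fun c => mul_le_mul_left ?_ _
        refine enorm_tsum_le_tsum_enorm.trans_eq ?_
        simp_rw [enorm_mul]
    _ = ∑' c, ∑' b, ‖K a b‖ₑ * (‖K' b c‖ₑ * g c) := by
        simp_rw [← ENNReal.tsum_mul_right, mul_assoc]
    _ = ∑' b, ‖K a b‖ₑ * ∑' c, ‖K' b c‖ₑ * g c := by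
        rw [ENNReal.tsum_comm]
        simp_rw [ENNReal.tsum_mul_left]

/-- The product `K_n ⋯ K_1` of infinite matrices. -/
def kprod : (n : ℕ) → (Fin n → S → S → 𝕜) → S → S → 𝕜
  | 0, _ => kone
  | n + 1, K => kmul (K (Fin.last n)) (kprod n fun i => K i.castSucc)

/-- The product `K_1 ⋯ K_n` of infinite matrices. -/
def kprodRev : (n : ℕ) → (Fin n → S → S → 𝕜) → S → S → 𝕜
  | 0, _ => kone
  | n + 1, K => kmul (kprodRev n fun i => K i.castSucc) (K (Fin.last n))

theorem Preserves.kprod (hG : IsGrowthClass Good) {n : ℕ} {K : Fin n → S → S → 𝕜}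
    (h : ∀ i, Preserves Good (K i)) : Preserves Good (kprod n K) := by
  induction n with
  | zero => exact Preserves.kone hG
  | succ n ih => exact (h _).kmul hG (ih fun i => h i.castSucc)

theorem Preserves.kprodRev (hG : IsGrowthClass Good) {n : ℕ} {K : Fin n → S → S → 𝕜}
    (h : ∀ i, Preserves Good (K i)) : Preserves Good (kprodRev n K) := by
  induction n with
  | zero => exact Preserves.kone hG
  | succ n ih => exact (ih fun i => h i.castSucc).kmul hG (h _)

variable [CompleteSpace 𝕜]

theorem Preserves.summable (hG : IsGrowthClass Good) (h : Preserves Good K)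
    (h' : Preserves Good K') (a c : S) : Summable fun b => K a b * K' b c :=
  (tsum_enorm_ne_top_iff_summable_norm.mp (h.tsum_ne_top hG h' a c)).of_norm

/-- The absolute double sum is `|K|` applied to `|K'|` applied to a column of `K''`. It stays in the
growth class, hence is finite, and the sums may be exchanged. -/
theorem kmul_assoc (hG : IsGrowthClass Good) (h : Preserves Good K) (h' : Preserves Good K')
    (h'' : Preserves Good K'') : kmul (kmul K K') K'' = kmul K (kmul K' K'') := by
  funext a d
  simp only [kmul, ← tsum_mul_left, ← tsum_mul_right, mul_assoc]
  refine Summable.tsum_comm (Summable.of_norm (tsum_enorm_ne_top_iff_summable_norm.mp ?_))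
  rw [ENNReal.tsum_prod']
  simp only [Function.uncurry, enorm_mul, ENNReal.tsum_mul_left]
  exact hG.ne_top (h _ (h' _ (h''.col hG d))) a

theorem kmul_kprod_comm (hG : IsGrowthClass Good) {n : ℕ} {K : Fin n → S → S → 𝕜} (r : Fin n → 𝕜)
    (hK : Preserves Good K') (h : ∀ i, Preserves Good (K i))
    (hc : ∀ i, kmul K' (K i) = r i • kmul (K i) K') :
    kmul K' (kprod n K) = (∏ i, r i) • kmul (kprod n K) K' := by
  induction n with
  | zero => simp [kprod, kmul_kone, kone_kmul]
  | succ n ih =>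
    have hp := Preserves.kprod hG fun i => h (Fin.castSucc i)
    rw [kprod, ← kmul_assoc hG hK (h _) hp, hc, smul_kmul, kmul_assoc hG (h _) hK hp,
      ih _ (fun i => h i.castSucc) fun i => hc i.castSucc, kmul_smul, kmul_assoc hG (h _) hp hK,
      smul_smul, Fin.prod_univ_castSucc, mul_comm]

theorem kprodRev_kmul_comm (hG : IsGrowthClass Good) {n : ℕ} {K : Fin n → S → S → 𝕜}
    (r : Fin n → 𝕜) (hK : Preserves Good K') (h : ∀ i, Preserves Good (K i))
    (hc : ∀ i, kmul (K i) K' = r i • kmul K' (K i)) :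
    kmul (kprodRev n K) K' = (∏ i, r i) • kmul K' (kprodRev n K) := by
  induction n with
  | zero => simp [kprodRev, kmul_kone, kone_kmul]
  | succ n ih =>
    have hp := Preserves.kprodRev hG fun i => h (Fin.castSucc i)
    rw [kprodRev, kmul_assoc hG hp (h _) hK, hc, kmul_smul, ← kmul_assoc hG hp hK (h _),
      ih _ (fun i => h i.castSucc) fun i => hc i.castSucc, smul_kmul, kmul_assoc hG hK hp (h _),
      smul_smul, Fin.prod_univ_castSucc, mul_comm]

end Kernel

/-! ### The two families of one-row matrices -/

section Rows

variable {𝕜 : Type*} [Field 𝕜] {q : 𝕜} {u v : ℕ → 𝕜}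

/-- The product over all columns of the factors of `cCoeff`. -/
def stateCoeff (q : 𝕜) (u v : ℕ → 𝕜) (a : ℕ →₀ ℕ) : 𝕜 :=
  a.prod fun k m => qPoch q (u k * v k) m / qPoch q q m

/-- The one-row matrix of `frakG`. -/
def gRow [DecidableEq 𝕜] (q : 𝕜) (u v : ℕ → 𝕜) (x : 𝕜) (a c : ℕ →₀ ℕ) : 𝕜 :=
  rowZ (fun k => qwWeight q x (u k) (v k)) a c

/-- The transposed one-row matrix of `frakJ`, conjugated by `stateCoeff`. -/
def jRow (q : 𝕜) (u v : ℕ → 𝕜) (y : 𝕜) (a c : ℕ →₀ ℕ) : 𝕜 :=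
  stateCoeff q u v c / stateCoeff q u v a * rowZ (fun k => hlWeight q y (v k) (u k)) c a

theorem qPoch_ne_zero {a : 𝕜} (h : ∀ s : ℕ, a * q ^ s ≠ 1) (m : ℕ) : qPoch q a m ≠ 0 :=
  Finset.prod_ne_zero_iff.mpr fun i _ => sub_ne_zero.mpr (h i).symm

theorem stateCoeff_eq_prod {a : ℕ →₀ ℕ} {N : ℕ} (h : tail a N = 0) :
    stateCoeff q u v a = ∏ k ∈ Finset.range N, qPoch q (u k * v k) (a k) / qPoch q q (a k) := by
  refine Finsupp.prod_of_support_subset _ (fun k hk => ?_) _ fun k _ => by simp [qPoch]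
  rw [Finset.mem_range]
  by_contra hk'
  exact Finsupp.mem_support_iff.mp hk (apply_eq_zero_of_tail h (not_lt.mp hk'))

theorem stateCoeff_ne_zero (hq : ∀ k : ℕ, q ^ (k + 1) ≠ 1)
    (huv : ∀ k s : ℕ, u k * v k * q ^ s ≠ 1) (a : ℕ →₀ ℕ) : stateCoeff q u v a ≠ 0 :=
  Finset.prod_ne_zero_iff.mpr fun k _ =>
    div_ne_zero (qPoch_ne_zero (huv k) _) (qPoch_self_ne_zero hq _)

theorem qwWeight_conservation [DecidableEq 𝕜] (x u v : 𝕜) {a b c d : ℕ}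
    (h : qwWeight q x u v a b c d ≠ 0) : a + b = c + d := by
  by_contra h'
  exact h (by rw [qwWeight, if_neg h'])

theorem hlWeight_conservation (x u v : 𝕜) {a b c d : ℕ} (h : hlWeight q x u v a b c d ≠ 0) :
    a + b = c + d := by
  rcases b with _ | _ | b <;> rcases d with _ | _ | d <;> simp only [hlWeight] at h
  all_goals first
    | exact absurd rfl h
    | (split_ifs at h with h1
       · omega
       · exact absurd rfl h)

theorem hlWeight_of_two_le (x u v : 𝕜) {a b c d : ℕ} (h : 2 ≤ d) :
    hlWeight q x u v a b c d = 0 := by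
  obtain ⟨d, rfl⟩ := Nat.exists_eq_add_of_le' h
  rcases b with _ | _ | b <;> rfl

theorem dualWeight_of_two_le_right (y u v : 𝕜) {a s' s : ℕ} (h : 2 ≤ s) :
    dualWeight q y u v a s' s = 0 := by
  obtain ⟨d, rfl⟩ := Nat.exists_eq_add_of_le' h
  rcases s' with _ | _ | b <;> rfl

theorem dualWeight_of_two_le_left (y u v : 𝕜) {a s' s : ℕ} (h : 2 ≤ s') :
    dualWeight q y u v a s' s = 0 := by
  obtain ⟨d, rfl⟩ := Nat.exists_eq_add_of_le' h
  rfl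

/-- The conjugation exchanges the factors `1 - q ^ k` and `1 - u v q ^ k` between the two vertices
with distinct horizontal labels, and does nothing when those labels agree. -/
theorem dualWeight_eq (hq : ∀ k : ℕ, q ^ (k + 1) ≠ 1) (y : 𝕜) {u v : 𝕜}
    (huv : ∀ s : ℕ, u * v * q ^ s ≠ 1) {a b s' s : ℕ} (h : b + s' = a + s) :
    (qPoch q (u * v) b / qPoch q q b) / (qPoch q (u * v) a / qPoch q q a) *
      hlWeight q y v u b s' a s = dualWeight q y u v a s' s := by
  have hA : ∀ k, qPoch q (u * v) k ≠ 0 := qPoch_ne_zero huv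
  have hB : ∀ k, qPoch q q k ≠ 0 := qPoch_self_ne_zero hq
  have hC : ∀ k, qPoch q (u * v) k / qPoch q q k ≠ 0 := fun k => div_ne_zero (hA k) (hB k)
  rcases Nat.lt_or_ge s 2 with hs | hs
  swap
  · rw [hlWeight_of_two_le _ _ _ hs, dualWeight_of_two_le_right _ _ _ hs, mul_zero]
  rcases Nat.lt_or_ge s' 2 with hs' | hs'
  swap
  · rw [dualWeight_of_two_le_left _ _ _ hs']
    obtain ⟨d, rfl⟩ := Nat.exists_eq_add_of_le' hs'
    simp [hlWeight]
  interval_cases s' <;> interval_cases s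
  · obtain rfl : b = a := by omega
    rw [div_self (hC b), one_mul]
    simp [hlWeight, dualWeight, div_eq_mul_inv]
  · obtain rfl : b = a + 1 := by omega
    have h1 := hB (a + 1)
    have h2 := hA a
    have h3 := hB a
    rw [qPoch_succ] at h1
    have h4 := right_ne_zero_of_mul h1
    rw [mul_comm q] at h4
    rw [hlWeight, if_pos rfl, dualWeight, qPoch_succ, qPoch_succ, pow_succ, mul_comm q]
    generalize (1 + v * y) = D
    field_simp
  · obtain rfl : a = b + 1 := by omega
    have h1 := hA (b + 1)
    have h2 := hA b
    have h3 := hB b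
    rw [qPoch_succ] at h1
    have h4 := right_ne_zero_of_mul h1
    rw [hlWeight, if_pos rfl, dualWeight, qPoch_succ, qPoch_succ, pow_succ', mul_comm v u]
    generalize (1 + v * y) = D
    field_simp
  · obtain rfl : b = a := by omega
    rw [div_self (hC b), one_mul]
    simp [hlWeight, dualWeight, div_eq_mul_inv]

theorem tail_le_of_gRow_ne_zero [DecidableEq 𝕜] {x : 𝕜} {a c : ℕ →₀ ℕ}
    (h : gRow q u v x a c ≠ 0) (k : ℕ) : tail c k ≤ tail a k :=
  tail_le_of_rowZ_ne_zero (fun _ _ _ _ _ => qwWeight_conservation _ _ _)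
    (fun _ => qwWeight_empty _ _ _ _) h k

theorem gRow_eq_prod [DecidableEq 𝕜] (hq : ∀ k : ℕ, q ^ (k + 1) ≠ 1) (x : 𝕜) {a c : ℕ →₀ ℕ}
    {N : ℕ} (ha : tail a N = 0) (hc : tail c N = 0) (hac : ∀ k, tail c k ≤ tail a k) :
    gRow q u v x a c = ∏ k ∈ Finset.range N,
      weightPoly q x (u k) (v k) (a k) (tail a (k + 1) - tail c (k + 1)) (c k) := by
  rw [gRow, rowZ_eq_prod (fun _ _ _ _ _ => qwWeight_conservation _ _ _)
    (fun _ => qwWeight_empty _ _ _ _) ha hc]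
  refine Finset.prod_congr rfl fun k _ => qwWeight_eq hq _ _ _ ?_
  have h1 := tail_succ a k
  have h2 := tail_succ c k
  have h3 := hac (k + 1)
  have h4 := hac k
  omega

theorem tail_le_of_jRow_ne_zero {y : 𝕜} (hy : ∀ k, 1 + v k * y ≠ 0) {a c : ℕ →₀ ℕ}
    (h : jRow q u v y a c ≠ 0) (k : ℕ) : tail a k ≤ tail c k :=
  tail_le_of_rowZ_ne_zero (fun _ _ _ _ _ => hlWeight_conservation _ _ _)
    (fun k => hlWeight_empty _ _ _ _ (hy k)) (right_ne_zero_of_mul h) k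

/-- Horizontal labels are at most 1, so one row enlarges each part of the partition by at most one.
-/
theorem tail_le_add_one_of_jRow_ne_zero {y : 𝕜} (hy : ∀ k, 1 + v k * y ≠ 0) {a c : ℕ →₀ ℕ}
    (h : jRow q u v y a c ≠ 0) (k : ℕ) : tail c k ≤ tail a k + 1 := by
  obtain ⟨N, hN⟩ := exists_tail_eq_zero a
  obtain ⟨N', hN'⟩ := exists_tail_eq_zero c
  have h1 := right_ne_zero_of_mul h
  rw [rowZ_eq_prod (fun _ _ _ _ _ => hlWeight_conservation _ _ _)
    (fun k => hlWeight_empty _ _ _ _ (hy k)) (tail_eq_zero_of_le hN' (le_max_right N N'))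
    (tail_eq_zero_of_le hN (le_max_left N N')), Finset.prod_ne_zero_iff] at h1
  rcases lt_or_ge k (max N N') with hk | hk
  · by_contra hk'
    exact h1 k (Finset.mem_range.mpr hk) (hlWeight_of_two_le _ _ _ (by omega))
  · rw [tail_eq_zero_of_le hN' (by omega)]
    omega

theorem jRow_eq_prod (hq : ∀ k : ℕ, q ^ (k + 1) ≠ 1) (huv : ∀ k s : ℕ, u k * v k * q ^ s ≠ 1)
    {y : 𝕜} (hy : ∀ k, 1 + v k * y ≠ 0) {a c : ℕ →₀ ℕ} {N : ℕ} (ha : tail a N = 0)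
    (hc : tail c N = 0) (hac : ∀ k, tail a k ≤ tail c k) :
    jRow q u v y a c = ∏ k ∈ Finset.range N,
      dualWeight q y (u k) (v k) (a k) (tail c (k + 1) - tail a (k + 1))
        (tail c k - tail a k) := by
  rw [jRow, rowZ_eq_prod (fun _ _ _ _ _ => hlWeight_conservation _ _ _)
    (fun k => hlWeight_empty _ _ _ _ (hy k)) hc ha, stateCoeff_eq_prod ha, stateCoeff_eq_prod hc,
    ← Finset.prod_div_distrib, ← Finset.prod_mul_distrib]
  refine Finset.prod_congr rfl fun k _ => dualWeight_eq hq _ (huv k) ?_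
  have h1 := tail_succ a k
  have h2 := tail_succ c k
  have h3 := hac (k + 1)
  have h4 := hac k
  omega

end Rows

/-! ### Commutation of two rows -/

section TwoRows

variable {𝕜 : Type*} [Field 𝕜] {q : 𝕜} {u v : ℕ → 𝕜}

/-- The intermediate state is determined by the labels `h` of the dual row, since its tails are
those of `a` plus `h`. The lower bound on `N` ensures that no state from a path with final label 0
is lost by the restriction to the box. -/
theorem sum_box_jRow_mul_gRow [DecidableEq 𝕜] (hq : ∀ k : ℕ, q ^ (k + 1) ≠ 1)
    (huv : ∀ k s : ℕ, u k * v k * q ^ s ≠ 1) (x : 𝕜) {y : 𝕜} (hy : ∀ k, 1 + v k * y ≠ 0)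
    (a c : ℕ →₀ ℕ) {N : ℕ} (ha : tail a N = 0) (hc : tail c N = 0) (hN : tail a 0 + 1 < N) :
    ∑ b ∈ box N, jRow q u v y a b * gRow q u v x b c =
      pathSum (fun k => lowerColumn q x y (u k) (v k) (a k) (c k) (tail a (k + 1))
        (tail c (k + 1))) 2 N 0 := by
  have hprod : ∀ b, tail b N = 0 → (∀ k, tail a k ≤ tail b k) → (∀ k, tail c k ≤ tail b k) →
      ∀ h : ℕ → ℕ, (∀ k, tail b k = tail a k + h k) → jRow q u v y a b * gRow q u v x b c =
        ∏ k ∈ Finset.range N, lowerColumn q x y (u k) (v k) (a k) (c k) (tail a (k + 1))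
          (tail c (k + 1)) (h (k + 1)) (h k) := by
    intro b hb h1 h2 h hh
    rw [jRow_eq_prod hq huv hy ha hb h1, gRow_eq_prod hq x hb hc h2, ← Finset.prod_mul_distrib]
    refine Finset.prod_congr rfl fun k _ => ?_
    have e1 := tail_succ a k
    have e2 := tail_succ b k
    have e3 := hh k
    have e4 := hh (k + 1)
    have e5 := h2 (k + 1)
    rw [lowerColumn_eq q x y (u k) (v k) (g := tail b (k + 1) - tail c (k + 1)) (k := b k)
      (by omega) (by omega)]
    congr 2 <;> omega
  refine sum_eq_pathSum _ 2 N (box N) _ (fun b k => tail b k - tail a k) ?_ ?_ ?_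
  · intro b hb hne
    have h1 := tail_le_of_jRow_ne_zero hy (left_ne_zero_of_mul hne)
    have h2 := tail_le_add_one_of_jRow_ne_zero hy (left_ne_zero_of_mul hne)
    have h3 := tail_le_of_gRow_ne_zero (right_ne_zero_of_mul hne)
    refine ⟨fun k _ => ?_, ?_, ?_⟩
    · have := h2 k
      omega
    · rw [tail_of_mem_box hb, Nat.zero_sub]
    · exact hprod b (tail_of_mem_box hb) h1 h3 (fun k => tail b k - tail a k) fun k => by have := h1 k; omega
  · intro b hb b' hb' hne hne' h
    refine tail_injective (funext fun k => ?_)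
    have h1 := tail_le_of_jRow_ne_zero hy (left_ne_zero_of_mul hne) k
    have h2 := tail_le_of_jRow_ne_zero hy (left_ne_zero_of_mul hne') k
    rcases lt_or_ge k N with hk | hk
    · have := h k hk
      omega
    · rw [tail_eq_zero_of_le (tail_of_mem_box hb) hk, tail_eq_zero_of_le (tail_of_mem_box hb') hk]
  · intro h h0 h2 hne
    rw [Finset.prod_ne_zero_iff] at hne
    have hf : Antitone fun k => tail a k + h k := by
      refine antitone_nat_of_succ_le fun k => ?_
      rcases lt_or_ge k N with hk | hk
      · have e1 := tail_succ a k
        have e2 := h2 k hk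
        have e3 : h (k + 1) < 2 := by
          rcases Nat.lt_or_ge (k + 1) N with hk' | hk'
          · exact h2 _ hk'
          · rw [h0 _ hk']; omega
        -- The tails fail to decrease only where `h` drops from 1 to 0 in a column with bottom label
        -- 0, and that column has weight zero.
        by_contra hlt
        obtain e4 : h (k + 1) = 1 := by omega
        obtain e5 : h k = 0 := by omega
        obtain e6 : a k = 0 := by omega
        refine hne k (Finset.mem_range.mpr hk) ?_
        rw [e4, e5, e6, lowerColumn]
        simp [dualWeight]
      · rw [tail_eq_zero_of_le ha hk, tail_eq_zero_of_le ha (hk.trans (Nat.le_succ k)), h0 k hk,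
          h0 (k + 1) (by omega)]
    obtain ⟨b, hb⟩ := exists_tail_eq hf (N := N) (by rw [ha, h0 N le_rfl])
    have hb' : ∀ k, tail b k = tail a k + h k := fun k => congrFun hb k
    have hbN : tail b N = 0 := by rw [hb', ha, h0 N le_rfl]
    refine ⟨b, mem_box hbN ?_, fun k _ => by rw [hb']; omega, ?_⟩
    · have := h2 0 (by omega)
      rw [hb']
      omega
    · refine hprod b hbN (fun k => by rw [hb']; omega) (fun k => ?_) h hb'
      rcases lt_or_ge k N with hk | hk
      · by_contra hlt
        refine hne k (Finset.mem_range.mpr hk) (lowerColumn_of_lt _ _ _ _ _ ?_)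
        have e1 := tail_succ a k
        have e2 := tail_succ c k
        have e3 := hb' k
        omega
      · rw [tail_eq_zero_of_le hc hk]
        omega

theorem sum_box_gRow_mul_jRow [DecidableEq 𝕜] (hq : ∀ k : ℕ, q ^ (k + 1) ≠ 1)
    (huv : ∀ k s : ℕ, u k * v k * q ^ s ≠ 1) (x : 𝕜) {y : 𝕜} (hy : ∀ k, 1 + v k * y ≠ 0)
    (a c : ℕ →₀ ℕ) {N : ℕ} (ha : tail a N = 0) (hc : tail c N = 0) (hN : tail c 0 < N) :
    ∑ b ∈ box N, gRow q u v x a b * jRow q u v y b c =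
      pathSum (fun k => upperColumn q x y (u k) (v k) (a k) (c k) (tail a (k + 1))
        (tail c (k + 1))) 2 N 0 := by
  have hprod : ∀ b, tail b N = 0 → (∀ k, tail b k ≤ tail a k) → (∀ k, tail b k ≤ tail c k) →
      ∀ h : ℕ → ℕ, (∀ k, tail b k + h k = tail c k) → gRow q u v x a b * jRow q u v y b c =
        ∏ k ∈ Finset.range N, upperColumn q x y (u k) (v k) (a k) (c k) (tail a (k + 1))
          (tail c (k + 1)) (h (k + 1)) (h k) := by
    intro b hb h1 h2 h hh
    rw [jRow_eq_prod hq huv hy hb hc h2, gRow_eq_prod hq x ha hb h1, ← Finset.prod_mul_distrib]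
    refine Finset.prod_congr rfl fun k _ => ?_
    have e1 := tail_succ c k
    have e2 := tail_succ b k
    have e3 := hh k
    have e4 := hh (k + 1)
    have e5 := h1 (k + 1)
    rw [upperColumn_eq q x y (u k) (v k) (g := tail a (k + 1) - tail b (k + 1)) (k := b k)
      (by omega) (by omega)]
    congr 2 <;> omega
  refine sum_eq_pathSum _ 2 N (box N) _ (fun b k => tail c k - tail b k) ?_ ?_ ?_
  · intro b hb hne
    have h1 := tail_le_of_jRow_ne_zero hy (right_ne_zero_of_mul hne)
    have h2 := tail_le_add_one_of_jRow_ne_zero hy (right_ne_zero_of_mul hne)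
    have h3 := tail_le_of_gRow_ne_zero (left_ne_zero_of_mul hne)
    refine ⟨fun k _ => ?_, ?_, ?_⟩
    · have := h2 k
      omega
    · rw [hc, Nat.zero_sub]
    · exact hprod b (tail_of_mem_box hb) h3 h1 (fun k => tail c k - tail b k) fun k => by have := h1 k; omega
  · intro b hb b' hb' hne hne' h
    refine tail_injective (funext fun k => ?_)
    have h1 := tail_le_of_jRow_ne_zero hy (right_ne_zero_of_mul hne) k
    have h2 := tail_le_of_jRow_ne_zero hy (right_ne_zero_of_mul hne') k
    rcases lt_or_ge k N with hk | hk
    · have := h k hk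
      omega
    · rw [tail_eq_zero_of_le (tail_of_mem_box hb) hk, tail_eq_zero_of_le (tail_of_mem_box hb') hk]
  · intro h h0 h2 hne
    rw [Finset.prod_ne_zero_iff] at hne
    -- This comes from the guard in `upperColumn`; it makes the subtraction `tail c k - h k` exact
    -- and the result decreasing.
    have hs : ∀ k, h k ≤ c k + h (k + 1) := by
      intro k
      rcases lt_or_ge k N with hk | hk
      · by_contra hlt
        refine hne k (Finset.mem_range.mpr hk) ?_
        rw [upperColumn, if_neg fun h' => hlt h'.2]
      · rw [h0 k hk]
        omega
    have hle : ∀ k, h k ≤ tail c k := by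
      refine of_succ (N := N) (fun k hk => by rw [h0 k hk]; omega) fun k hk => ?_
      rw [tail_succ]
      exact (hs k).trans (by omega)
    have hf : Antitone fun k => tail c k - h k := by
      refine antitone_nat_of_succ_le fun k => ?_
      have e1 := tail_succ c k
      have e2 := hs k
      have e3 := hle k
      have e4 := hle (k + 1)
      omega
    obtain ⟨b, hb⟩ := exists_tail_eq hf (N := N) (by rw [hc, Nat.zero_sub])
    have hb' : ∀ k, tail b k + h k = tail c k := fun k => by
      have e1 := congrFun hb k
      have e2 := hle k
      omega
    have hbN : tail b N = 0 := by have := hb' N; omega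
    refine ⟨b, mem_box hbN ?_, fun k _ => by rw [← hb']; omega, ?_⟩
    · have := hb' 0
      omega
    · refine hprod b hbN (fun k => ?_) (fun k => by rw [← hb']; omega) h hb'
      rcases lt_or_ge k N with hk | hk
      · by_contra hlt
        refine hne k (Finset.mem_range.mpr hk) (upperColumn_of_lt _ _ _ _ _ ?_)
        have e1 := tail_succ a k
        have e2 := tail_succ c k
        have e3 := hb' k
        omega
      · rw [tail_eq_zero_of_le hbN hk]
        omega

/-- With no columns both stackings equal 1, and the coefficients on the left of each relation add up
to `1 + z`; this is where the free right boundary enters. -/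
theorem exchange_pathSum (hq : ∀ k : ℕ, q ^ (k + 1) ≠ 1) (x y : 𝕜) (a c : ℕ →₀ ℕ) (N : ℕ) :
    Exchange q (x * y) (tail a N) (tail c N)
      (pathSum (fun k => lowerColumn q x y (u k) (v k) (a k) (c k) (tail a (k + 1))
        (tail c (k + 1))) 2 N)
      (pathSum (fun k => upperColumn q x y (u k) (v k) (a k) (c k) (tail a (k + 1))
        (tail c (k + 1))) 2 N) := by
  induction N with
  | zero => exact ⟨fun _ => by simp [pathSum], fun _ => by simp only [pathSum]; ring⟩
  | succ N ih =>
    rw [tail_succ a, tail_succ c, add_comm, add_comm (c N)] at ih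
    exact ih.step hq x y (u N) (v N)

/-- In an empty column a dual label 1 on the left cannot become 0 on the right, because of the
factor `1 - q ^ 0`. The label 1 in both rows passes through with the stated factor. -/
theorem pathSum_lowerColumn_succ (hq : ∀ k : ℕ, q ^ (k + 1) ≠ 1) (x y : 𝕜) {a c : ℕ →₀ ℕ} {N : ℕ} (ha : tail a N = 0)
    (hc : tail c N = 0) :
    pathSum (fun k => lowerColumn q x y (u k) (v k) (a k) (c k) (tail a (k + 1))
        (tail c (k + 1))) 2 (N + 1) 1 =
      v N * ((y + u N) / (1 + v N * y)) *
        pathSum (fun k => lowerColumn q x y (u k) (v k) (a k) (c k) (tail a (k + 1))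
          (tail c (k + 1))) 2 N 1 := by
  rw [pathSum, Finset.sum_range_succ, Finset.sum_range_one,
    tail_eq_zero_of_le ha (Nat.le_succ N), tail_eq_zero_of_le hc (Nat.le_succ N),
    apply_eq_zero_of_tail ha le_rfl, apply_eq_zero_of_tail hc le_rfl]
  have h0 : lowerColumn q x y (u N) (v N) 0 0 0 0 1 0 = 0 := by simp [lowerColumn, dualWeight]
  have h1 : lowerColumn q x y (u N) (v N) 0 0 0 0 1 1 = v N * ((y + u N) / (1 + v N * y)) := by
    rw [lowerColumn_eq q x y (u N) (v N) (g := 1) (k := 0) rfl rfl, weightPoly_succ_zero hq,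
      weightPoly_zero hq, qBinom_self hq, dualWeight]
    simp only [qPoch, Finset.prod_range_zero, pow_zero]
    ring
  rw [h0, h1, zero_mul, zero_add]

end TwoRows

/-! ### Passage to infinitely many columns -/

section Commute

variable {𝕜 : Type*} [NormedField 𝕜] {q : 𝕜} {u v : ℕ → 𝕜}

/-- Under the first alternative one vanishing factor annihilates everything after it; under the
second the decay is geometric. -/
theorem tendsto_zero_of_succ_eq_mul {F δ : ℕ → 𝕜} {N : ℕ}
    (hF : ∀ n, N ≤ n → F (n + 1) = δ n * F n)
    (hδ : (∃ᶠ k in atTop, δ k = 0) ∨ ∃ ρ : ℝ, ρ < 1 ∧ ∀ᶠ k in atTop, ‖δ k‖ ≤ ρ) :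
    Tendsto F atTop (nhds 0) := by
  rcases hδ with h | ⟨ρ, hρ, h⟩
  · obtain ⟨n, hn, h0⟩ := (frequently_atTop.mp h) N
    refine tendsto_const_nhds.congr' (eventually_atTop.mpr ⟨n + 1, fun k hk => ?_⟩)
    induction k, hk using Nat.le_induction with
    | base => rw [hF n hn, h0, zero_mul]
    | succ k hk ih => rw [hF k (by omega), ← ih, mul_zero]
  · obtain ⟨M, hM⟩ := eventually_atTop.mp h
    have hρ0 : 0 ≤ ρ := (norm_nonneg _).trans (hM M le_rfl)
    have hb : ∀ n, ‖F (max N M + n)‖ ≤ ρ ^ n * ‖F (max N M)‖ := by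
      intro n
      induction n with
      | zero => simp
      | succ n ih =>
        rw [← add_assoc, hF _ (by omega), norm_mul, pow_succ', mul_assoc]
        exact mul_le_mul (hM _ (by omega)) ih (norm_nonneg _) hρ0
    refine (tendsto_add_atTop_iff_nat (max N M)).mp ?_
    have h0 := (tendsto_pow_atTop_nhds_zero_of_lt_one hρ0 hρ).mul_const ‖F (max N M)‖
    rw [zero_mul] at h0
    exact squeeze_zero_norm (fun n => by rw [add_comm]; exact hb n) h0

theorem kmul_jRow_gRow [DecidableEq 𝕜] (hq : ∀ k : ℕ, q ^ (k + 1) ≠ 1)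
    (huv : ∀ k s : ℕ, u k * v k * q ^ s ≠ 1) (x : 𝕜) {y : 𝕜} (hy : ∀ k, 1 + v k * y ≠ 0)
    (hδ : (∃ᶠ k in atTop, v k * ((y + u k) / (1 + v k * y)) = 0) ∨
      ∃ ρ : ℝ, ρ < 1 ∧ ∀ᶠ k in atTop, ‖v k * ((y + u k) / (1 + v k * y))‖ ≤ ρ)
    (hs : ∀ a c, Summable fun b => jRow q u v y a b * gRow q u v x b c) :
    kmul (jRow q u v y) (gRow q u v x) = (1 + x * y) • kmul (gRow q u v x) (jRow q u v y) := by
  funext a c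
  obtain ⟨A, hA⟩ := exists_tail_eq_zero a
  obtain ⟨C, hC⟩ := exists_tail_eq_zero c
  have ha : ∀ n, max A C ≤ n → tail a n = 0 := fun n hn => tail_eq_zero_of_le hA (by omega)
  have hc : ∀ n, max A C ≤ n → tail c n = 0 := fun n hn => tail_eq_zero_of_le hC (by omega)
  set F := pathSum (fun k => lowerColumn q x y (u k) (v k) (a k) (c k) (tail a (k + 1))
    (tail c (k + 1))) 2 with hF
  have h1 : Tendsto (fun n => F n 1) atTop (nhds 0) :=
    tendsto_zero_of_succ_eq_mul (N := max A C)
      (fun n hn => pathSum_lowerColumn_succ hq x y (ha n hn) (hc n hn)) hδ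
  -- Left label 0 at column `n` confines the intermediate state to the box, so `F n 0` is a partial
  -- sum.
  have h2 : Tendsto (fun n => F n 0) atTop (nhds (kmul (jRow q u v y) (gRow q u v x) a c)) := by
    refine ((hs a c).hasSum.comp tendsto_box).congr' ?_
    filter_upwards [eventually_ge_atTop (max A C), eventually_gt_atTop (tail a 0 + 1)] with n hn hn'
    exact sum_box_jRow_mul_gRow hq huv x hy a c (ha n hn) (hc n hn) hn'
  -- The opposite product is a finite sum, since intermediate states are contained in `c`; it is
  -- already complete for large `n`.
  have h3 : ∀ᶠ n in atTop, F n 0 + x * y * F n 1 =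
      (1 + x * y) * kmul (gRow q u v x) (jRow q u v y) a c := by
    filter_upwards [eventually_ge_atTop (max A C), eventually_gt_atTop (tail c 0)] with n hn hn'
    rw [(exchange_pathSum hq x y a c n).1 (by rw [hc n hn]; omega),
      ← sum_box_gRow_mul_jRow hq huv x hy a c (ha n hn) (hc n hn) hn', kmul, tsum_eq_sum]
    intro b hb
    by_contra hne
    have h4 := tail_le_of_jRow_ne_zero hy (right_ne_zero_of_mul hne)
    have h5 := h4 n
    have h6 := h4 0
    rw [hc n hn] at h5
    exact hb (mem_box (Nat.le_zero.mp h5) (by omega))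
  have h4 := h2.add (h1.const_mul (x * y))
  rw [mul_zero, add_zero] at h4
  exact tendsto_nhds_unique h4 (tendsto_const_nhds.congr' (h3.mono fun n hn => hn.symm))

end Commute

/-! ### Growth estimates -/

section PathBounds

theorem pathSum_nonneg {t : ℕ → ℕ → ℕ → ℝ} (ht : ∀ k s' s, 0 ≤ t k s' s) (D N s : ℕ) :
    0 ≤ pathSum t D N s := by
  induction N generalizing s with
  | zero => exact zero_le_one
  | succ N ih => exact Finset.sum_nonneg fun r _ => mul_nonneg (ht _ _ _) (ih r)

theorem card_filter_lt_succ_of_mem {s : Finset ℕ} {N : ℕ} (hN : N ∈ s) :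
    (s.filter (· < N + 1)).card = (s.filter (· < N)).card + 1 := by
  have hf : s.filter (· < N + 1) = insert N (s.filter (· < N)) := by
    ext k
    simp only [Finset.mem_filter, Finset.mem_insert]
    refine ⟨fun h => ?_, ?_⟩
    · rcases (Nat.lt_succ_iff_lt_or_eq.mp h.2) with h' | h'
      · exact Or.inr ⟨h.1, h'⟩
      · exact Or.inl h'
    · rintro (rfl | h)
      · exact ⟨hN, Nat.lt_succ_self _⟩
      · exact ⟨h.1, h.2.trans (Nat.lt_succ_self _)⟩
  rw [hf, Finset.card_insert_of_notMem (by simp)]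

theorem filter_lt_succ_of_notMem {s : Finset ℕ} {N : ℕ} (hN : N ∉ s) :
    s.filter (· < N + 1) = s.filter (· < N) := by
  refine Finset.filter_congr fun k hk => ?_
  have : k ≠ N := fun h => hN (h ▸ hk)
  omega

/-- The quantity `F 0 + α F 1` serves as a potential: good columns do not increase it, and bad
columns multiply it by at most a constant. -/
theorem exists_pathSum_two_le {B ρ : ℝ} (hB : 1 ≤ B) (hρ0 : 0 ≤ ρ) (hρ : ρ < 1) :
    ∃ α C : ℝ, 0 ≤ α ∧ 1 ≤ C ∧ ∀ (t : ℕ → ℕ → ℕ → ℝ) (bad : Finset ℕ), (∀ k s' s, 0 ≤ t k s' s) →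
      (∀ k, ∀ s' < 2, ∀ s < 2, t k s' s ≤ B) →
      (∀ k ∉ bad, t k 0 0 ≤ 1 ∧ t k 1 0 = 0 ∧ t k 1 1 ≤ ρ) →
      ∀ N, pathSum t 2 N 0 ≤ C ^ bad.card * (1 + α) := by
  have h1ρ : 0 < 1 - ρ := by linarith
  -- Chosen so that `B + α ρ = α`: a good column maps `F 0 + α F 1` to at most itself.
  set α := B / (1 - ρ) with hα
  have hα1 : 1 ≤ α := by rw [hα, le_div_iff₀ h1ρ]; linarith
  have hαB : B + α * ρ = α := by rw [hα]; field_simp; ring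
  have hC : 1 ≤ B * (1 + α) := by nlinarith
  refine ⟨α, B * (1 + α), by linarith, hC, fun t bad ht htB hgood N => ?_⟩
  have key : ∀ N, pathSum t 2 N 0 + α * pathSum t 2 N 1 ≤
      (B * (1 + α)) ^ (bad.filter (· < N)).card * (1 + α) := by
    intro N
    induction N with
    | zero => simp [pathSum]
    | succ N ih =>
      have hF0 := pathSum_nonneg ht 2 N 0
      have hF1 := pathSum_nonneg ht 2 N 1
      have e : ∀ s, pathSum t 2 (N + 1) s = t N s 0 * pathSum t 2 N 0 + t N s 1 * pathSum t 2 N 1 :=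
        fun s => by rw [pathSum, Finset.sum_range_succ, Finset.sum_range_one]
      rw [e, e]
      by_cases hN : N ∈ bad
      · rw [card_filter_lt_succ_of_mem hN, pow_succ', mul_assoc]
        refine le_trans ?_ (mul_le_mul_of_nonneg_left ih (by linarith))
        have b00 := mul_le_mul_of_nonneg_right (htB N 0 (by omega) 0 (by omega)) hF0
        have b01 := mul_le_mul_of_nonneg_right (htB N 0 (by omega) 1 (by omega)) hF1
        have b10 := mul_le_mul_of_nonneg_right (htB N 1 (by omega) 0 (by omega)) hF0
        have b11 := mul_le_mul_of_nonneg_right (htB N 1 (by omega) 1 (by omega)) hF1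
        have b1 := mul_le_mul_of_nonneg_left (add_le_add b10 b11) (by linarith : 0 ≤ α)
        have b2 : B * (1 + α) * pathSum t 2 N 1 ≤ B * (1 + α) * (α * pathSum t 2 N 1) :=
          mul_le_mul_of_nonneg_left (le_mul_of_one_le_left hF1 hα1) (by linarith)
        linarith
      · obtain ⟨g00, g10, g11⟩ := hgood N hN
        rw [filter_lt_succ_of_notMem hN]
        refine le_trans ?_ ih
        have b00 := mul_le_mul_of_nonneg_right g00 hF0
        have b01 := mul_le_mul_of_nonneg_right (htB N 0 (by omega) 1 (by omega)) hF1
        have b11 := mul_le_mul_of_nonneg_left (mul_le_mul_of_nonneg_right g11 hF1)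
          (by linarith : 0 ≤ α)
        rw [g10, zero_mul, zero_add]
        have : α * (ρ * pathSum t 2 N 1) + B * pathSum t 2 N 1 = α * pathSum t 2 N 1 := by
          rw [← hαB]
          ring_nf
          rw [hα]
          field_simp
          ring
        linarith
  have h1 := key N
  have h2 := mul_nonneg (by linarith : 0 ≤ α) (pathSum_nonneg ht 2 N 1)
  have h3 : (B * (1 + α)) ^ (bad.filter (· < N)).card ≤ (B * (1 + α)) ^ bad.card :=
    pow_le_pow_right₀ hC (Finset.card_le_card (Finset.filter_subset _ _))
  have h4 := mul_le_mul_of_nonneg_right h3 (by linarith : 0 ≤ 1 + α)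
  linarith

/-- In a good column the labels cannot increase from left to right, and non-zero diagonal entries
contract. A bound geometric in the left label is therefore stable under good columns. -/
theorem exists_pathSum_le (D : ℕ) {B σ : ℝ} (hB : 1 ≤ B) (hσ0 : 0 ≤ σ) (hσ : σ < 1) :
    ∃ C : ℝ, 1 ≤ C ∧ ∀ (t : ℕ → ℕ → ℕ → ℝ) (bad : Finset ℕ), (∀ k s' s, 0 ≤ t k s' s) →
      (∀ k, ∀ s' ≤ D, ∀ s ≤ D, t k s' s ≤ B) →
      (∀ k ∉ bad, t k 0 0 ≤ 1 ∧ (∀ s', ∀ s > s', t k s' s = 0) ∧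
        ∀ s ≤ D, 1 ≤ s → t k s s ≤ σ) →
      ∀ N, pathSum t (D + 1) N 0 ≤ C ^ bad.card := by
  have h1σ : 0 < 1 - σ := by linarith
  have hB0 : 0 < B := by linarith
  -- With `(β - 1) (1 - σ) = B`, the off-diagonal part `B (1 + β + ⋯ + β ^ (s - 1))` is at most `(1
  -- - σ) β ^ s`, which fills the gap left by the diagonal.
  set β := 1 + B / (1 - σ) with hβ
  have hβ1 : 1 ≤ β := by
    have : 0 ≤ B / (1 - σ) := by positivity
    linarith
  have hβB : (1 - σ) * β = (1 - σ) + B := by rw [hβ]; field_simp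
  have hgeom : ∀ m : ℕ, B * ∑ g ∈ Finset.range m, β ^ g ≤ (1 - σ) * β ^ m := by
    intro m
    induction m with
    | zero => simp; linarith
    | succ m ih =>
      rw [Finset.sum_range_succ, mul_add, pow_succ', ← mul_assoc, hβB, add_mul]
      linarith
  set C := B * ((D + 1 : ℕ) * β ^ D) with hC'
  have hC : 1 ≤ C := by
    have h1 : (1 : ℝ) ≤ ((D + 1 : ℕ) : ℝ) := by exact_mod_cast Nat.succ_le_succ (Nat.zero_le D)
    exact one_le_mul_of_one_le_of_one_le hB (one_le_mul_of_one_le_of_one_le h1 (one_le_pow₀ hβ1))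
  refine ⟨C, hC, fun t bad ht htB hgood N => ?_⟩
  have key : ∀ N, ∀ s ≤ D, pathSum t (D + 1) N s ≤
      C ^ (bad.filter (· < N)).card * β ^ s := by
    intro N
    induction N with
    | zero =>
      intro s _
      simpa [pathSum] using one_le_pow₀ hβ1
    | succ N ih =>
      intro s' hs'
      set X := C ^ (bad.filter (· < N)).card with hX
      have hX0 : 0 ≤ X := by positivity
      rw [pathSum]
      by_cases hN : N ∈ bad
      · rw [card_filter_lt_succ_of_mem hN, pow_succ', ← hX]
        have h1 : ∀ s ∈ Finset.range (D + 1), t N s' s * pathSum t (D + 1) N s ≤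
            B * (X * β ^ D) := by
          intro s hs
          rw [Finset.mem_range, Nat.lt_succ_iff] at hs
          refine mul_le_mul (htB N s' hs' s hs) ((ih s hs).trans ?_) (pathSum_nonneg ht _ _ _) hB0.le
          exact mul_le_mul_of_nonneg_left (pow_le_pow_right₀ hβ1 hs) hX0
        refine (Finset.sum_le_sum h1).trans ?_
        rw [Finset.sum_const, Finset.card_range, nsmul_eq_mul]
        have h2 : C * X ≤ C * X * β ^ s' :=
          le_mul_of_one_le_right (by positivity) (one_le_pow₀ hβ1)
        refine le_trans (le_of_eq ?_) h2
        rw [hC']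
        ring
      · obtain ⟨g0, g1, g2⟩ := hgood N hN
        rw [filter_lt_succ_of_notMem hN, ← hX]
        have h1 : ∑ s ∈ Finset.range (D + 1), t N s' s * pathSum t (D + 1) N s =
            ∑ s ∈ Finset.range (s' + 1), t N s' s * pathSum t (D + 1) N s := by
          symm
          refine Finset.sum_subset (Finset.range_subset_range.mpr (by omega)) fun s _ hs => ?_
          rw [Finset.mem_range, not_lt] at hs
          rw [g1 s' s hs, zero_mul]
        rw [h1, Finset.sum_range_succ]
        rcases s' with _ | s'
        · rw [Finset.sum_range_zero, zero_add]
          refine (mul_le_mul g0 (ih 0 hs') (pathSum_nonneg ht _ _ _) zero_le_one).trans ?_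
          rw [one_mul]
        · have h2 : ∑ s ∈ Finset.range (s' + 1), t N (s' + 1) s * pathSum t (D + 1) N s ≤
              X * (B * ∑ s ∈ Finset.range (s' + 1), β ^ s) := by
            rw [Finset.mul_sum, Finset.mul_sum]
            refine Finset.sum_le_sum fun s hs => ?_
            rw [Finset.mem_range] at hs
            refine (mul_le_mul (htB N _ hs' s (by omega)) (ih s (by omega))
              (pathSum_nonneg ht _ _ _) hB0.le).trans_eq (by ring)
          have h3 := mul_le_mul (g2 _ hs' (by omega)) (ih _ hs') (pathSum_nonneg ht _ _ _) hσ0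
          have h4 := mul_le_mul_of_nonneg_left (hgeom (s' + 1)) hX0
          calc _ ≤ X * ((1 - σ) * β ^ (s' + 1)) + σ * (X * β ^ (s' + 1)) := by linarith
            _ = X * β ^ (s' + 1) := by ring
  refine (key N 0 (Nat.zero_le D)).trans ?_
  rw [pow_zero, mul_one]
  exact pow_le_pow_right₀ hC (Finset.card_le_card (Finset.filter_subset _ _))

end PathBounds

/-! ### Growth classes for the two convergence conditions -/

section Growth

open scoped ENNReal

/-! ### Vanishing parameters -/

/-- Finite functions supported on the label sequences that vanish from some column on. -/
def BoundedSupport (g : (ℕ →₀ ℕ) → ℝ≥0∞) : Prop :=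
  (∀ a, g a ≠ ⊤) ∧ ∃ N, ∀ a, g a ≠ 0 → tail a N = 0

theorem isGrowthClass_boundedSupport : IsGrowthClass BoundedSupport where
  mono {f g} h hg := by
    obtain ⟨h1, N, hN⟩ := hg
    exact ⟨fun a => ne_top_of_le_ne_top (h1 a) (h a), N, fun a ha =>
      hN a fun h0 => ha (le_zero_iff.mp (h0 ▸ h a))⟩
  ne_top hg := hg.1
  single c := by
    obtain ⟨N, hN⟩ := exists_tail_eq_zero c
    refine ⟨fun a => ?_, N, fun a ha => ?_⟩
    · by_cases h : a = c <;> simp [h]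
    · have : a = c := by
        by_contra h
        simp [h] at ha
      rw [this, hN]

theorem tsum_ne_top_of_finite {α : Type*} {f : α → ℝ≥0∞} (h : ∀ a, f a ≠ ⊤)
    (hf : (Function.support f).Finite) : ∑' a, f a ≠ ⊤ := by
  rw [tsum_eq_sum (s := hf.toFinset) fun a ha => by simpa using ha]
  exact ENNReal.sum_ne_top.mpr fun a _ => h a

variable {𝕜 : Type*} [NormedField 𝕜] {q : 𝕜} {u v : ℕ → 𝕜}

theorem preserves_boundedSupport {K : (ℕ →₀ ℕ) → (ℕ →₀ ℕ) → 𝕜}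
    (hfin : ∀ a N, {b | K a b ≠ 0 ∧ tail b N = 0}.Finite)
    (htail : ∀ N, ∃ N', ∀ a b, K a b ≠ 0 → tail b N = 0 → tail a N' = 0) :
    Preserves BoundedSupport K := by
  rintro g ⟨hg, N, hN⟩
  have hsupp : ∀ a b, ‖K a b‖ₑ * g b ≠ 0 → K a b ≠ 0 ∧ tail b N = 0 := by
    intro a b h
    exact ⟨by simpa using left_ne_zero_of_mul h, hN b (right_ne_zero_of_mul h)⟩
  refine ⟨fun a => tsum_ne_top_of_finite (fun b => ENNReal.mul_ne_top enorm_ne_top (hg b))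
    ((hfin a N).subset fun b hb => hsupp a b hb), ?_⟩
  obtain ⟨N', hN'⟩ := htail N
  refine ⟨N', fun a ha => ?_⟩
  have : ∃ b, ‖K a b‖ₑ * g b ≠ 0 := by
    by_contra h
    push Not at h
    exact ha (by simp [h])
  obtain ⟨b, hb⟩ := this
  exact hN' a b (hsupp a b hb).1 (hsupp a b hb).2

theorem jRow_preserves_boundedSupport {y : 𝕜} (hy : ∀ k, 1 + v k * y ≠ 0) :
    Preserves BoundedSupport (jRow q u v y) := by
  refine preserves_boundedSupport (fun a N => ?_) fun N => ⟨N, fun a b h hb => ?_⟩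
  · refine (box (max N (tail a 0 + 2))).finite_toSet.subset fun b hb => ?_
    have := tail_le_add_one_of_jRow_ne_zero hy hb.1 0
    exact mem_box (tail_eq_zero_of_le hb.2 (le_max_left _ _)) (by omega)
  · exact Nat.le_zero.mp (hb ▸ tail_le_of_jRow_ne_zero hy h N)

/-- A column with `v = 0` and top label 0 admits no non-zero left label, so it stops the state below
from reaching farther left. -/
theorem gRow_preserves_boundedSupport [DecidableEq 𝕜] (hq : ∀ k : ℕ, q ^ (k + 1) ≠ 1) (x : 𝕜)
    (hv : ∃ᶠ k in atTop, v k = 0) : Preserves BoundedSupport (gRow q u v x) := by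
  refine preserves_boundedSupport (fun a N => ?_) fun N => ?_
  · exact (finite_tail_le a).subset fun b hb => tail_le_of_gRow_ne_zero hb.1
  · obtain ⟨N', hN', hv'⟩ := (frequently_atTop.mp hv) N
    refine ⟨N' + 1, fun a b h hb => ?_⟩
    obtain ⟨M, hM⟩ := exists_tail_eq_zero a
    have hle := tail_le_of_gRow_ne_zero h
    rw [gRow_eq_prod hq x (tail_eq_zero_of_le hM (le_max_left M (N' + 1)))
      (tail_eq_zero_of_le hb (by omega)) hle, Finset.prod_ne_zero_iff] at h
    have h1 := h N' (Finset.mem_range.mpr (by omega))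
    rw [tail_eq_zero_of_le hb (by omega), Nat.sub_zero, apply_eq_zero_of_tail hb hN', hv'] at h1
    by_contra hne
    obtain ⟨p, hp⟩ := Nat.exists_eq_succ_of_ne_zero hne
    exact h1 (by rw [hp, Nat.succ_eq_add_one, weightPoly_succ_zero hq, zero_mul])

/-! ### Decaying parameters -/

/-- The weight `∏_k (w k)^(tail a (k + 1))` of a label sequence. -/
def tailWeight (w : ℕ → ℝ) (a : ℕ →₀ ℕ) : ℝ := ∏ᶠ k, w k ^ tail a (k + 1)

theorem tailWeight_eq (w : ℕ → ℝ) {a : ℕ →₀ ℕ} {N : ℕ} (h : tail a N = 0) :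
    tailWeight w a = ∏ k ∈ Finset.range N, w k ^ tail a (k + 1) := by
  refine finprod_eq_prod_of_mulSupport_subset _ fun k hk => ?_
  rw [Finset.coe_range, Set.mem_Iio]
  by_contra hk'
  exact hk (by simp only [tail_eq_zero_of_le h (by omega : N ≤ k + 1), pow_zero])

theorem tailWeight_pos {w : ℕ → ℝ} (hw : ∀ k, 0 < w k) (a : ℕ →₀ ℕ) : 0 < tailWeight w a := by
  obtain ⟨N, hN⟩ := exists_tail_eq_zero a
  rw [tailWeight_eq w hN]
  exact Finset.prod_pos fun k _ => pow_pos (hw k) _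

/-- Functions bounded by a multiple of `tailWeight w` on label sequences of bounded sum. -/
def WeightBounded (w : ℕ → ℝ) (g : (ℕ →₀ ℕ) → ℝ≥0∞) : Prop :=
  ∀ D, ∃ K : ℝ, ∀ a, tail a 0 ≤ D → g a ≤ ENNReal.ofReal (K * tailWeight w a)

theorem isGrowthClass_weightBounded {w : ℕ → ℝ} (hw : ∀ k, 0 < w k) :
    IsGrowthClass (WeightBounded w) where
  mono {f g} h hg D := by
    obtain ⟨K, hK⟩ := hg D
    exact ⟨K, fun a ha => (h a).trans (hK a ha)⟩
  ne_top hg a := by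
    obtain ⟨K, hK⟩ := hg (tail a 0)
    exact ne_top_of_le_ne_top ENNReal.ofReal_ne_top (hK a le_rfl)
  single c D := by
    refine ⟨(tailWeight w c)⁻¹, fun a _ => ?_⟩
    by_cases h : a = c
    · rw [h, inv_mul_cancel₀ (tailWeight_pos hw c).ne']
      simp
    · simp [h]

/-- A weighted Schur test, with constants depending only on the total label `tail a 0`. -/
theorem preserves_weightBounded {w : ℕ → ℝ} (hw : ∀ k, 0 < w k)
    {K : (ℕ →₀ ℕ) → (ℕ →₀ ℕ) → 𝕜}
    (htail : ∀ a b, K a b ≠ 0 → tail b 0 ≤ tail a 0 + 1)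
    (hsum : ∀ D, ∃ C : ℝ, ∀ a, tail a 0 ≤ D → ∀ᶠ n in atTop,
      ∑ b ∈ box n, ‖K a b‖ * tailWeight w b / tailWeight w a ≤ C) :
    Preserves (WeightBounded w) K := by
  intro g hg D
  -- A dual row may raise the total label by one.
  obtain ⟨M, hM⟩ := hg (D + 1)
  obtain ⟨C, hC⟩ := hsum D
  refine ⟨max M 0 * C, fun a ha => ?_⟩
  have hφ := tailWeight_pos hw
  have hterm : ∀ b, ‖K a b‖ₑ * g b ≤
      ENNReal.ofReal (max M 0 * tailWeight w a * (‖K a b‖ * tailWeight w b / tailWeight w a)) := by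
    intro b
    by_cases hK : K a b = 0
    · simp [hK]
    · have h1 := hM b (by have := htail a b hK; omega)
      rw [← ofReal_norm]
      refine (mul_le_mul_right h1 _).trans ?_
      rw [← ENNReal.ofReal_mul (norm_nonneg _)]
      refine ENNReal.ofReal_le_ofReal ?_
      have h2 : max M 0 * tailWeight w a * (‖K a b‖ * tailWeight w b / tailWeight w a) =
          ‖K a b‖ * (max M 0 * tailWeight w b) := by
        field_simp [(hφ a).ne']
      rw [h2]
      exact mul_le_mul_of_nonneg_left
        (mul_le_mul_of_nonneg_right (le_max_left _ _) (hφ b).le) (norm_nonneg _)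
  have hnn : ∀ b, 0 ≤ ‖K a b‖ * tailWeight w b / tailWeight w a := fun b =>
    div_nonneg (mul_nonneg (norm_nonneg _) (hφ b).le) (hφ a).le
  have hc : 0 ≤ max M 0 * tailWeight w a := mul_nonneg (le_max_right _ _) (hφ a).le
  refine le_of_tendsto (ENNReal.summable.hasSum.comp tendsto_box) ?_
  filter_upwards [hC a ha] with n hn
  refine (Finset.sum_le_sum fun b _ => hterm b).trans ?_
  rw [← ENNReal.ofReal_sum_of_nonneg fun b _ => mul_nonneg hc (hnn b), ← Finset.mul_sum]
  refine ENNReal.ofReal_le_ofReal ((mul_le_mul_of_nonneg_left hn hc).trans_eq (by ring))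

end Growth

/-! ### Weighted bounds for both kinds of rows when the parameters are bounded -/

section Decay

variable {𝕜 : Type*} [NormedField 𝕜] {q : 𝕜} {u v : ℕ → 𝕜}

/-- Bounded sequences. -/
def BoundedSeq (f : ℕ → 𝕜) : Prop := ∃ C : ℝ, ∀ k, ‖f k‖ ≤ C

theorem BoundedSeq.const (c : 𝕜) : BoundedSeq fun _ => c := ⟨‖c‖, fun _ => le_rfl⟩

theorem BoundedSeq.mul {f g : ℕ → 𝕜} (hf : BoundedSeq f) (hg : BoundedSeq g) :
    BoundedSeq fun k => f k * g k := by
  obtain ⟨C, hC⟩ := hf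
  obtain ⟨D, hD⟩ := hg
  refine ⟨C * D, fun k => ?_⟩
  rw [norm_mul]
  exact mul_le_mul (hC k) (hD k) (norm_nonneg _) ((norm_nonneg _).trans (hC k))

theorem BoundedSeq.add {f g : ℕ → 𝕜} (hf : BoundedSeq f) (hg : BoundedSeq g) :
    BoundedSeq fun k => f k + g k := by
  obtain ⟨C, hC⟩ := hf
  obtain ⟨D, hD⟩ := hg
  exact ⟨C + D, fun k => (norm_add_le _ _).trans (add_le_add (hC k) (hD k))⟩

theorem BoundedSeq.one_sub {f : ℕ → 𝕜} (hf : BoundedSeq f) : BoundedSeq fun k => 1 - f k := by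
  simpa [sub_eq_add_neg] using (BoundedSeq.const 1).add ((BoundedSeq.const (-1)).mul hf)

theorem BoundedSeq.pow {f : ℕ → 𝕜} (hf : BoundedSeq f) (n : ℕ) : BoundedSeq fun k => f k ^ n := by
  induction n with
  | zero => simpa using BoundedSeq.const (1 : 𝕜)
  | succ n ih => simpa only [pow_succ] using ih.mul hf

theorem BoundedSeq.sum {ι : Type*} {s : Finset ι} {f : ι → ℕ → 𝕜}
    (hf : ∀ i ∈ s, BoundedSeq (f i)) : BoundedSeq fun k => ∑ i ∈ s, f i k := by
  classical
  induction s using Finset.induction_on with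
  | empty => simpa using BoundedSeq.const (0 : 𝕜)
  | insert i s hi ih =>
    simp only [Finset.sum_insert hi]
    exact (hf i (Finset.mem_insert_self i s)).add
      (ih fun j hj => hf j (Finset.mem_insert_of_mem hj))

theorem BoundedSeq.qPoch {f : ℕ → 𝕜} (hf : BoundedSeq f) (n : ℕ) :
    BoundedSeq fun k => qPoch q (f k) n := by
  induction n with
  | zero => simpa [LatticeCauchy.qPoch] using BoundedSeq.const (1 : 𝕜)
  | succ n ih =>
    simp only [qPoch_succ]
    exact ih.mul (hf.mul (BoundedSeq.const _)).one_sub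

theorem BoundedSeq.weightPoly (hu : BoundedSeq u) (hv : BoundedSeq v) (x : 𝕜) (a b c : ℕ) :
    BoundedSeq fun k => weightPoly q x (u k) (v k) a b c := by
  refine BoundedSeq.sum fun i _ => ?_
  exact (((((BoundedSeq.const _).mul ((hu.mul (.const x)).qPoch _)).mul (.const _)).mul (.const _)).mul
    (((hu.mul hv).mul (.const _)).qPoch _)).mul ((hv.mul (.const _)).pow _)

theorem BoundedSeq.dualWeight (hu : BoundedSeq u) (hv : BoundedSeq v) {y : 𝕜}
    (hy : BoundedSeq fun k => (1 + v k * y)⁻¹) (a s' s : ℕ) :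
    BoundedSeq fun k => dualWeight q y (u k) (v k) a s' s := by
  rcases s' with _ | _ | s' <;> rcases s with _ | _ | s
  · exact ((BoundedSeq.const 1).add ((hv.mul (.const _)).mul (.const _))).mul hy
  · exact (((hu.mul hv).mul (.const _)).one_sub.mul (.const _)).mul hy
  · exact .const 0
  · exact (BoundedSeq.const _).mul hy
  · exact ((BoundedSeq.const _).add (hu.mul (.const _))).mul hy
  · exact .const 0
  · exact .const 0
  · exact .const 0
  · exact .const 0

theorem exists_common_bound {ι : Type*} (s : Finset ι) {f : ι → ℕ → 𝕜}
    (hf : ∀ i, BoundedSeq (f i)) : ∃ C : ℝ, 1 ≤ C ∧ ∀ i ∈ s, ∀ k, ‖f i k‖ ≤ C := by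
  choose C hC using hf
  obtain ⟨M, hM⟩ := (s.image C).exists_le
  exact ⟨max 1 M, le_max_left _ _, fun i hi k => (hC i k).trans
    ((hM _ (Finset.mem_image_of_mem C hi)).trans (le_max_right _ _))⟩

theorem card_support_le_tail (a : ℕ →₀ ℕ) : a.support.card ≤ tail a 0 := by
  rw [tail, Finsupp.sum, Finset.card_eq_sum_ones]
  refine Finset.sum_le_sum fun k hk => ?_
  simpa [Nat.one_le_iff_ne_zero] using hk

theorem weightPoly_zero_zero (hq : ∀ k : ℕ, q ^ (k + 1) ≠ 1) (x u v : 𝕜) (b : ℕ) :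
    weightPoly q x u v 0 b 0 = v ^ b := by
  induction b with
  | zero => simp [weightPoly_zero hq, qBinom_self hq, qPoch]
  | succ b ih => rw [weightPoly_succ_zero hq, ih, pow_succ']

/-- The ratio of tail weights contributes `w k` for each label 1 entering column `k` from the left.
Far out, a label 1 running through an empty column then costs a factor at most `ρ`. All other
columns are at most `k₀ + D` in number. -/
theorem jRow_preserves_weightBounded (hq : ∀ k : ℕ, q ^ (k + 1) ≠ 1)
    (huv : ∀ k s : ℕ, u k * v k * q ^ s ≠ 1) {y : 𝕜} (hy : ∀ k, 1 + v k * y ≠ 0)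
    {w : ℕ → ℝ} (hw : ∀ k, 0 < w k) {W : ℝ} (hwW : ∀ k, w k ≤ W)
    (hu : BoundedSeq u) (hv : BoundedSeq v) (hyb : BoundedSeq fun k => (1 + v k * y)⁻¹)
    {ρ : ℝ} (hρ : ρ < 1) (hd : ∀ᶠ k in atTop, w k * ‖(y + u k) / (1 + v k * y)‖ ≤ ρ) :
    Preserves (WeightBounded w) (jRow q u v y) := by
  refine preserves_weightBounded hw
    (fun a b h => tail_le_add_one_of_jRow_ne_zero hy h 0) fun D => ?_
  obtain ⟨k₀, hk₀⟩ := eventually_atTop.mp hd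
  have hρ0 : 0 ≤ ρ := (mul_nonneg (hw k₀).le (norm_nonneg _)).trans (hk₀ k₀ le_rfl)
  obtain ⟨B, hB1, hB⟩ := exists_common_bound (Finset.range (D + 1) ×ˢ Finset.range 2 ×ˢ
    Finset.range 2) fun i : ℕ × ℕ × ℕ => BoundedSeq.dualWeight (q := q) hu hv hyb i.1 i.2.1 i.2.2
  set W' := max W 1
  have hB' : 1 ≤ B * W' := one_le_mul_of_one_le_of_one_le hB1 (le_max_right _ _)
  obtain ⟨α, C, hα, hC, hpath⟩ := exists_pathSum_two_le hB' hρ0 hρ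
  refine ⟨C ^ (k₀ + D) * (1 + α), fun a ha => ?_⟩
  obtain ⟨N, hN⟩ := exists_tail_eq_zero a
  filter_upwards [eventually_ge_atTop N] with n hn
  have han := tail_eq_zero_of_le hN hn
  set t : ℕ → ℕ → ℕ → ℝ := fun k s' s => ‖dualWeight q y (u k) (v k) (a k) s' s‖ * w k ^ s'
    with ht_def
  have ht : ∀ k s' s, 0 ≤ t k s' s := fun k s' s =>
    mul_nonneg (norm_nonneg _) (pow_nonneg (hw k).le _)
  have h1 : ∑ b ∈ box n, ‖jRow q u v y a b‖ * tailWeight w b / tailWeight w a ≤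
      pathSum t 2 n 0 := by
    refine sum_le_pathSum t ht 2 n (box n) _ (fun b k => tail b k - tail a k) ?_ ?_
    · intro b hb hne
      have hne' : jRow q u v y a b ≠ 0 := fun h => hne (by simp [h])
      have e1 := tail_le_of_jRow_ne_zero hy hne'
      have e2 := tail_le_add_one_of_jRow_ne_zero hy hne'
      have hbn := tail_of_mem_box hb
      refine ⟨fun k _ => ?_, by rw [hbn, Nat.zero_sub], le_of_eq ?_⟩
      · have := e2 k
        omega
      · rw [jRow_eq_prod hq huv hy han hbn e1, norm_prod, tailWeight_eq w han,
          tailWeight_eq w hbn, ← Finset.prod_mul_distrib, ← Finset.prod_div_distrib]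
        refine Finset.prod_congr rfl fun k _ => ?_
        simp only [ht_def]
        rw [pow_sub₀ _ (hw k).ne' (e1 (k + 1)), mul_div_assoc, div_eq_mul_inv]
    · intro b hb b' hb' hne hne' h
      have hne1 : jRow q u v y a b ≠ 0 := fun h => hne (by simp [h])
      have hne2 : jRow q u v y a b' ≠ 0 := fun h => hne' (by simp [h])
      refine tail_injective (funext fun k => ?_)
      rcases lt_or_ge k n with hk | hk
      · have h1 := tail_le_of_jRow_ne_zero hy hne1 k
        have h2 := tail_le_of_jRow_ne_zero hy hne2 k
        have := h k hk
        omega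
      · rw [tail_eq_zero_of_le (tail_of_mem_box hb) hk,
          tail_eq_zero_of_le (tail_of_mem_box hb') hk]
  -- Bad columns are those before the decay sets in and those with a non-zero bottom label.
  refine h1.trans ((hpath t (Finset.range k₀ ∪ a.support) ht ?_ ?_ n).trans ?_)
  · intro k s' hs' s hs
    have hak : a k ≤ D := (apply_le_tail a k).trans ((tail_antitone a (Nat.zero_le k)).trans ha)
    refine mul_le_mul (hB (a k, s', s) ?_ k) ?_ (pow_nonneg (hw k).le _) (by linarith)
    · simp only [Finset.mem_product, Finset.mem_range]
      omega
    · interval_cases s'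
      · simp [W']
      · exact (pow_one (w k)).trans_le ((hwW k).trans (le_max_left W 1))
  · intro k hk
    rw [Finset.mem_union, not_or, Finset.mem_range, not_lt, Finsupp.notMem_support_iff] at hk
    refine ⟨?_, ?_, ?_⟩
    · simp [t, hk.2, dualWeight, hy k]
    · simp [t, hk.2, dualWeight]
    · have := hk₀ k hk.1
      simpa [t, hk.2, dualWeight, div_eq_mul_inv, mul_comm] using this
  · refine mul_le_mul_of_nonneg_right (pow_le_pow_right₀ hC ?_) (by linarith)
    refine (Finset.card_union_le _ _).trans ?_
    rw [Finset.card_range]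
    exact Nat.add_le_add_left ((card_support_le_tail a).trans ha) k₀

/-- Here the weight ratio contributes the inverse power of `w k`. Through a column with both
vertical labels 0, a horizontal label `s` passes with weight `(v k / w k) ^ s` in absolute value.
The lower bound `w₀` controls the columns where the bottom label is non-zero or the horizontal label
changes. -/
theorem gRow_preserves_weightBounded [DecidableEq 𝕜] (hq : ∀ k : ℕ, q ^ (k + 1) ≠ 1) (x : 𝕜)
    {w : ℕ → ℝ} {w₀ : ℝ} (hw₀ : 0 < w₀) (hw : ∀ k, w₀ ≤ w k)
    (hu : BoundedSeq u) (hv : BoundedSeq v) {σ : ℝ} (hσ0 : 0 ≤ σ) (hσ : σ < 1)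
    (hvw : ∀ k, ‖v k‖ ≤ σ * w k) : Preserves (WeightBounded w) (gRow q u v x) := by
  have hw' : ∀ k, 0 < w k := fun k => hw₀.trans_le (hw k)
  refine preserves_weightBounded hw'
    (fun a b h => (tail_le_of_gRow_ne_zero h 0).trans (Nat.le_succ _)) fun D => ?_
  -- Bottom and left labels are at most `D`, hence by conservation the top label is at most `2 * D`.
  obtain ⟨B, hB1, hB⟩ := exists_common_bound (Finset.range (D + 1) ×ˢ Finset.range (D + 1) ×ˢ
    Finset.range (2 * D + 1)) fun i : ℕ × ℕ × ℕ =>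
      BoundedSeq.weightPoly (q := q) hu hv x i.1 i.2.1 i.2.2
  set W := max w₀⁻¹ 1
  have hW1 : 1 ≤ W := le_max_right _ _
  have hB' : 1 ≤ B * W ^ D := one_le_mul_of_one_le_of_one_le hB1 (one_le_pow₀ hW1)
  obtain ⟨C, hC, hpath⟩ := exists_pathSum_le D hB' hσ0 hσ
  refine ⟨C ^ D, fun a ha => ?_⟩
  obtain ⟨N, hN⟩ := exists_tail_eq_zero a
  filter_upwards [eventually_ge_atTop N] with n hn
  have han := tail_eq_zero_of_le hN hn
  set t : ℕ → ℕ → ℕ → ℝ := fun k s' s => if s ≤ a k + s' then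
    ‖weightPoly q x (u k) (v k) (a k) s' (a k + s' - s)‖ * (w k)⁻¹ ^ s' else 0 with ht_def
  have ht : ∀ k s' s, 0 ≤ t k s' s := by
    intro k s' s
    simp only [ht_def]
    split_ifs
    · exact mul_nonneg (norm_nonneg _) (pow_nonneg (inv_nonneg.mpr (hw' k).le) _)
    · exact le_rfl
  have h1 : ∑ b ∈ box n, ‖gRow q u v x a b‖ * tailWeight w b / tailWeight w a ≤
      pathSum t (D + 1) n 0 := by
    refine sum_le_pathSum t ht (D + 1) n (box n) _ (fun b k => tail a k - tail b k) ?_ ?_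
    · intro b hb hne
      have hne' : gRow q u v x a b ≠ 0 := fun h => hne (by simp [h])
      have e1 := tail_le_of_gRow_ne_zero hne'
      have hbn := tail_of_mem_box hb
      refine ⟨fun k _ => ?_, by rw [han, Nat.zero_sub], le_of_eq ?_⟩
      · have := tail_antitone a (Nat.zero_le k)
        omega
      · rw [gRow_eq_prod hq x han hbn e1, norm_prod, tailWeight_eq w han,
          tailWeight_eq w hbn, ← Finset.prod_mul_distrib, ← Finset.prod_div_distrib]
        refine Finset.prod_congr rfl fun k _ => ?_
        have f1 := tail_succ a k
        have f2 := tail_succ b k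
        have f3 := e1 k
        have f4 := e1 (k + 1)
        have f5 : a k + (tail a (k + 1) - tail b (k + 1)) - (tail a k - tail b k) = b k := by omega
        simp only [ht_def]
        rw [if_pos (by omega), f5, mul_div_assoc]
        congr 1
        rw [inv_pow, div_eq_iff (pow_pos (hw' k) _).ne', eq_comm, inv_mul_eq_iff_eq_mul₀
          (pow_pos (hw' k) _).ne', ← pow_add]
        congr 1
        omega
    · intro b hb b' hb' hne hne' h
      have hne1 : gRow q u v x a b ≠ 0 := fun h => hne (by simp [h])
      have hne2 : gRow q u v x a b' ≠ 0 := fun h => hne' (by simp [h])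
      refine tail_injective (funext fun k => ?_)
      rcases lt_or_ge k n with hk | hk
      · have h1 := tail_le_of_gRow_ne_zero hne1 k
        have h2 := tail_le_of_gRow_ne_zero hne2 k
        have := h k hk
        omega
      · rw [tail_eq_zero_of_le (tail_of_mem_box hb) hk,
          tail_eq_zero_of_le (tail_of_mem_box hb') hk]
  refine h1.trans ((hpath t a.support ht ?_ ?_ n).trans
    (pow_le_pow_right₀ hC ((card_support_le_tail a).trans ha)))
  · intro k s' hs' s hs
    have hak : a k ≤ D := (apply_le_tail a k).trans ((tail_antitone a (Nat.zero_le k)).trans ha)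
    simp only [ht_def]
    split_ifs
    · refine mul_le_mul (hB (a k, s', a k + s' - s) ?_ k) ?_
        (pow_nonneg (inv_nonneg.mpr (hw' k).le) _) (by linarith)
      · simp only [Finset.mem_product, Finset.mem_range]
        omega
      · refine (pow_le_pow_left₀ (inv_nonneg.mpr (hw' k).le) ?_ _).trans
          (pow_le_pow_right₀ hW1 hs')
        exact ((inv_le_inv₀ (hw' k) hw₀).mpr (hw k)).trans (le_max_left _ _)
    · linarith
  · intro k hk
    rw [Finsupp.notMem_support_iff] at hk
    have hd : ∀ s, t k s s = (‖v k‖ * (w k)⁻¹) ^ s := by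
      intro s
      simp only [ht_def]
      rw [if_pos (by omega), hk, zero_add, Nat.sub_self, weightPoly_zero_zero hq, norm_pow, mul_pow]
    refine ⟨by rw [hd, pow_zero], fun s' s hs => ?_, fun s _ hs => ?_⟩
    · simp only [ht_def]
      rw [if_neg (by omega)]
    · have h2 : ‖v k‖ * (w k)⁻¹ ≤ σ := by
        rw [← div_eq_mul_inv, div_le_iff₀ (hw' k)]
        exact hvw k
      have h3 : 0 ≤ ‖v k‖ * (w k)⁻¹ := mul_nonneg (norm_nonneg _) (inv_nonneg.mpr (hw' k).le)
      rw [hd]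
      calc (‖v k‖ * (w k)⁻¹) ^ s ≤ σ ^ s := pow_le_pow_left₀ h3 h2 s
        _ ≤ σ ^ 1 := pow_le_pow_of_le_one hσ0 hσ.le hs
        _ = σ := pow_one σ

end Decay

/-! ### Partitions and label sequences -/

section Partitions

/-- The rows of length `k + 1` are those with index between two successive column lengths. -/
theorem count_rowLens (κ : YoungDiagram) (k : ℕ) :
    κ.rowLens.count (k + 1) = κ.transpose.rowLen k - κ.transpose.rowLen (k + 1) := by
  have h1 : κ.rowLens.count (k + 1) =
      ((Finset.range (κ.colLen 0)).filter fun i => κ.rowLen i = k + 1).card := by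
    rw [YoungDiagram.rowLens, List.count, List.countP_map, List.countP_eq_length_filter]
    rfl
  have h2 : ((Finset.range (κ.colLen 0)).filter fun i => κ.rowLen i = k + 1) =
      Finset.Ico (κ.colLen (k + 1)) (κ.colLen k) := by
    ext i
    rw [Finset.mem_filter, Finset.mem_range, Finset.mem_Ico]
    have e1 := κ.mem_iff_lt_rowLen (i := i) (j := k)
    have e2 := κ.mem_iff_lt_rowLen (i := i) (j := k + 1)
    rw [YoungDiagram.mem_iff_lt_colLen] at e1 e2
    have e3 := κ.colLen_anti 0 k (Nat.zero_le k)
    omega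
  rw [h1, h2, Nat.card_Ico, YoungDiagram.rowLen_transpose, YoungDiagram.rowLen_transpose]

theorem mult_apply (κ : YoungDiagram) (k : ℕ) :
    mult κ k = κ.transpose.rowLen k - κ.transpose.rowLen (k + 1) :=
  count_rowLens κ k

/-- The tails of the label sequence of the conjugate are the parts of the partition, so containment
of diagrams becomes the pointwise order of tails. -/
theorem tail_mult_transpose (κ : YoungDiagram) (k : ℕ) : tail (mult κ.transpose) k = κ.rowLen k := by
  have hm : ∀ k, mult κ.transpose k = κ.rowLen k - κ.rowLen (k + 1) := fun k => by
    rw [mult_apply, YoungDiagram.transpose_transpose]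
  have hz : ∀ k, κ.colLen 0 ≤ k → κ.rowLen k = 0 := by
    intro k hk
    by_contra h
    have h1 := κ.mem_iff_lt_rowLen.mpr (Nat.pos_of_ne_zero h)
    rw [YoungDiagram.mem_iff_lt_colLen] at h1
    omega
  have h0 : tail (mult κ.transpose) (κ.colLen 0) = 0 :=
    tail_eq_zero_iff.mpr fun k hk => by rw [hm, hz k hk, Nat.zero_sub]
  refine of_succ (P := fun k => tail (mult κ.transpose) k = κ.rowLen k) (N := κ.colLen 0)
    (fun k hk => by rw [hz k hk, tail_eq_zero_of_le h0 hk]) (fun k hk => ?_) k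
  have := κ.rowLen_anti k (k + 1) (Nat.le_succ k)
  rw [tail_succ, hk, hm]
  omega

theorem le_iff_rowLen_le {κ ν : YoungDiagram} : κ ≤ ν ↔ ∀ k, κ.rowLen k ≤ ν.rowLen k := by
  rw [← YoungDiagram.cells_subset_iff]
  refine ⟨fun h k => ?_, fun h c hc => ?_⟩
  · by_contra hlt
    have h1 : (k, ν.rowLen k) ∈ κ := κ.mem_iff_lt_rowLen.mpr (not_le.mp hlt)
    exact lt_irrefl _ (ν.mem_iff_lt_rowLen.mp (h h1))
  · obtain ⟨i, j⟩ := c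
    exact ν.mem_iff_lt_rowLen.mpr ((κ.mem_iff_lt_rowLen.mp hc).trans_le (h i))

theorem le_iff_tail_le {κ ν : YoungDiagram} :
    κ ≤ ν ↔ ∀ k, tail (mult κ.transpose) k ≤ tail (mult ν.transpose) k := by
  simp_rw [tail_mult_transpose]
  exact le_iff_rowLen_le

theorem bijective_mult_transpose :
    Function.Bijective fun κ : YoungDiagram => mult κ.transpose := by
  refine ⟨fun κ ν h => ?_, fun a => ?_⟩
  · simp only at h
    exact le_antisymm (le_iff_tail_le.mpr fun k => by rw [h]) (le_iff_tail_le.mpr fun k => by rw [h])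
  · obtain ⟨N, hN⟩ := exists_tail_eq_zero a
    let κ : YoungDiagram :=
      { cells := (Finset.range N ×ˢ Finset.range (tail a 0)).filter fun c => c.2 < tail a c.1
        isLowerSet := by
          rintro ⟨i, j⟩ ⟨i', j'⟩ ⟨h1, h2⟩ h
          simp only [Finset.coe_filter, Finset.mem_product, Finset.mem_range] at h ⊢
          have h3 := tail_antitone a h1
          simp only at h1 h2 h3
          change (i < N ∧ j < tail a 0) ∧ j < tail a i at h
          change (i' < N ∧ j' < tail a 0) ∧ j' < tail a i'
          omega }
    have hmem : ∀ i j, (i, j) ∈ κ ↔ j < tail a i := by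
      intro i j
      rw [← YoungDiagram.mem_cells, Finset.mem_filter, Finset.mem_product, Finset.mem_range,
        Finset.mem_range]
      refine ⟨fun h => h.2, fun h => ⟨⟨?_, h.trans_le (tail_antitone a (Nat.zero_le i))⟩, h⟩⟩
      by_contra hi
      rw [tail_eq_zero_of_le hN (not_lt.mp hi)] at h
      exact Nat.not_lt_zero j h
    refine ⟨κ, tail_injective (funext fun k => ?_)⟩
    rw [tail_mult_transpose]
    have h1 := hmem k (tail a k)
    have h2 := hmem k (κ.rowLen k)
    rw [YoungDiagram.mem_iff_lt_rowLen] at h1 h2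
    omega

/-- Partitions correspond to label sequences. -/
def partitionEquiv : YoungDiagram ≃ (ℕ →₀ ℕ) := Equiv.ofBijective _ bijective_mult_transpose

theorem cCoeff_eq_stateCoeff {𝕜 : Type*} [Field 𝕜] (q : 𝕜) (u v : ℕ → 𝕜) (κ : YoungDiagram) :
    cCoeff q u v κ = stateCoeff q u v (mult κ) :=
  (Finsupp.prod_of_support_subset (mult κ) (s := Finset.range (κ.rowLen 0))
    Finsupp.support_onFinset_subset (fun k m => qPoch q (u k * v k) m / qPoch q q m)
    fun k _ => by simp [qPoch]).symm

end Partitions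

/-! ### Lattices with several rows -/

section Lattices

variable {𝕜 : Type*} [NormedField 𝕜] {q : 𝕜} {u v : ℕ → 𝕜}

theorem latticeZ_eq_kprod [DecidableEq 𝕜] (q : 𝕜) (u v : ℕ → 𝕜) {n : ℕ} (x : Fin n → 𝕜)
    (a c : ℕ →₀ ℕ) : latticeZ (fun z k => qwWeight q z (u k) (v k)) n x a c =
      kprod n (fun i => gRow q u v (x i)) a c := by
  induction n generalizing a with
  | zero => simp [latticeZ, kprod, kone]
  | succ n ih =>
    simp only [latticeZ, kprod, kmul, ih]
    refine (tsum_eq_finsum ((finite_tail_le a).subset fun b hb => ?_)).symm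
    exact tail_le_of_gRow_ne_zero (left_ne_zero_of_mul hb)

/-- Transposition reverses the order of the rows, and the conjugating ratios telescope over the
intermediate states. -/
theorem latticeZ_eq_kprodRev (hq : ∀ k : ℕ, q ^ (k + 1) ≠ 1)
    (huv : ∀ k s : ℕ, u k * v k * q ^ s ≠ 1) {m : ℕ} {y : Fin m → 𝕜}
    (hy : ∀ k j, 1 + v k * y j ≠ 0) (a c : ℕ →₀ ℕ) :
    stateCoeff q u v c / stateCoeff q u v a *
        latticeZ (fun z k => hlWeight q z (v k) (u k)) m y c a =
      kprodRev m (fun j => jRow q u v (y j)) a c := by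
  have hc := stateCoeff_ne_zero hq huv
  induction m generalizing c with
  | zero =>
    by_cases h : a = c
    · simp [latticeZ, kprodRev, kone, h, div_self (hc c)]
    · simp [latticeZ, kprodRev, kone, h, Ne.symm h]
  | succ m ih =>
    simp only [latticeZ, kprodRev, kmul, ← ih fun k j => hy k j.castSucc]
    rw [tsum_eq_finsum ((finite_tail_le c).subset fun b hb =>
      tail_le_of_jRow_ne_zero (fun k => hy k _) (right_ne_zero_of_mul hb)), mul_finsum]
    refine finsum_congr fun b => ?_
    rw [jRow]
    field_simp [hc a, hc b]

theorem tail_le_of_kprod_ne_zero [DecidableEq 𝕜] {n : ℕ} {x : Fin n → 𝕜} {a c : ℕ →₀ ℕ}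
    (h : kprod n (fun i => gRow q u v (x i)) a c ≠ 0) (k : ℕ) : tail c k ≤ tail a k := by
  induction n generalizing a with
  | zero =>
    have : a = c := by
      by_contra h'
      simp [kprod, kone, h'] at h
    rw [this]
  | succ n ih =>
    obtain ⟨b, hb⟩ : ∃ b, gRow q u v (x (Fin.last n)) a b *
        kprod n (fun i => gRow q u v (x i.castSucc)) b c ≠ 0 := by
      by_contra! h'
      exact h (by simp [kprod, kmul, h'])
    exact (ih (right_ne_zero_of_mul hb)).trans
      (tail_le_of_gRow_ne_zero (left_ne_zero_of_mul hb) k)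

theorem tail_le_of_kprodRev_ne_zero {m : ℕ} {y : Fin m → 𝕜} (hy : ∀ k j, 1 + v k * y j ≠ 0)
    {a c : ℕ →₀ ℕ} (h : kprodRev m (fun j => jRow q u v (y j)) a c ≠ 0) (k : ℕ) :
    tail a k ≤ tail c k := by
  induction m generalizing c with
  | zero =>
    have : a = c := by
      by_contra h'
      simp [kprodRev, kone, h'] at h
    rw [this]
  | succ m ih =>
    obtain ⟨b, hb⟩ : ∃ b, kprodRev m (fun j => jRow q u v (y j.castSucc)) a b *
        jRow q u v (y (Fin.last m)) b c ≠ 0 := by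
      by_contra! h'
      exact h (by simp [kprodRev, kmul, h'])
    exact (ih (fun k j => hy k j.castSucc) (left_ne_zero_of_mul hb)).trans
      (tail_le_of_jRow_ne_zero (fun k => hy k _) (right_ne_zero_of_mul hb) k)

theorem BoundedSeq.of_eventually {f : ℕ → 𝕜} {C : ℝ} (h : ∀ᶠ k in atTop, ‖f k‖ ≤ C) :
    BoundedSeq f := by
  obtain ⟨N, hN⟩ := eventually_atTop.mp h
  obtain ⟨M, hM⟩ := ((Finset.range N).image fun k => ‖f k‖).exists_le
  refine ⟨max C M, fun k => ?_⟩
  rcases lt_or_ge k N with hk | hk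
  · exact (hM _ (Finset.mem_image_of_mem _ (Finset.mem_range.mpr hk))).trans (le_max_right _ _)
  · exact (hN k hk).trans (le_max_left _ _)

/-- Under condition (b) the weight must satisfy two opposing demands: `w k` has to exceed `‖v k‖` by
a fixed factor, while `w k * ‖(y j + u k) / (1 + v k * y j)‖` stays below a constant less than 1.
There is room for both because the product of these two quantities is at most `ρ < 1`. -/
theorem exists_isGrowthClass_preserves [DecidableEq 𝕜] (hq : ∀ k : ℕ, q ^ (k + 1) ≠ 1)
    (huv : ∀ k s : ℕ, u k * v k * q ^ s ≠ 1) {m : ℕ} {y : Fin m → 𝕜}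
    (hy : ∀ k j, 1 + v k * y j ≠ 0)
    (hconv : (∃ᶠ k in atTop, v k = 0) ∨
      ∃ C ρ : ℝ, ρ < 1 ∧ ∀ᶠ k in atTop, ‖u k‖ ≤ C ∧ ‖v k‖ ≤ C ∧
        ∀ j : Fin m, ‖(1 + v k * y j)⁻¹‖ ≤ C ∧ ‖v k * ((y j + u k) / (1 + v k * y j))‖ ≤ ρ) :
    ∃ Good, IsGrowthClass Good ∧ (∀ j, Preserves Good (jRow q u v (y j))) ∧
      ∀ x, Preserves Good (gRow q u v x) := by
  rcases hconv with hv0 | ⟨C, ρ, hρ, hev⟩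
  · exact ⟨BoundedSupport, isGrowthClass_boundedSupport,
      fun j => jRow_preserves_boundedSupport fun k => hy k j,
      fun x => gRow_preserves_boundedSupport hq x hv0⟩
  have hu : BoundedSeq u := .of_eventually (hev.mono fun k h => h.1)
  have hv : BoundedSeq v := .of_eventually (hev.mono fun k h => h.2.1)
  have hyb : ∀ j, BoundedSeq fun k => (1 + v k * y j)⁻¹ := fun j =>
    .of_eventually (hev.mono fun k h => (h.2.2 j).1)
  have hr : ∀ j, BoundedSeq fun k => (y j + u k) / (1 + v k * y j) := fun j => by
    simpa only [div_eq_mul_inv] using ((BoundedSeq.const (y j)).add hu).mul (hyb j)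
  obtain ⟨R, hR1, hR⟩ := exists_common_bound Finset.univ hr
  obtain ⟨V, hV⟩ := hv
  -- The maximum with 1/2 makes the rate positive, so that one can divide by it.
  set r := max ρ (1 / 2) with hr_def
  have hr0 : 0 < r := lt_of_lt_of_le (by norm_num) (le_max_right _ _)
  have hr1 : r < 1 := max_lt hρ (by norm_num)
  -- A factor `τ > 1` for which `τ * r` is the midpoint of `r` and 1, still below 1.
  set τ := (1 + r) / (2 * r) with hτ_def
  have hτr : τ * r = (1 + r) / 2 := by rw [hτ_def]; field_simp
  have hτ1 : 1 < τ := by rw [hτ_def, lt_div_iff₀ (by linarith)]; linarith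
  have hτ0 : 0 < τ := by linarith
  -- This floor keeps `w` away from zero where `v k` is small, and `ε * R = r` preserves the upper
  -- bound.
  set ε := r / R with hε_def
  have hR0 : 0 < R := by linarith
  have hε0 : 0 < ε := div_pos hr0 hR0
  set w : ℕ → ℝ := fun k => τ * max ‖v k‖ ε with hw_def
  have hw0 : ∀ k, τ * ε ≤ w k := fun k => mul_le_mul_of_nonneg_left (le_max_right _ _) hτ0.le
  have hwpos : ∀ k, 0 < w k := fun k => (mul_pos hτ0 hε0).trans_le (hw0 k)
  have hwW : ∀ k, w k ≤ τ * max V ε := fun k =>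
    mul_le_mul_of_nonneg_left (max_le_max (hV k) le_rfl) hτ0.le
  refine ⟨WeightBounded w, isGrowthClass_weightBounded hwpos, fun j => ?_, fun x => ?_⟩
  · refine jRow_preserves_weightBounded hq huv (fun k => hy k j) hwpos hwW hu ⟨V, hV⟩ (hyb j)
      (ρ := (1 + r) / 2) (by linarith) (hev.mono fun k hk => ?_)
    rw [← hτr, hw_def, mul_assoc]
    refine mul_le_mul_of_nonneg_left ?_ hτ0.le
    rw [max_mul_of_nonneg _ _ (norm_nonneg _)]
    refine max_le ?_ ?_
    · rw [← norm_mul]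
      exact (hk.2.2 j).2.trans (le_max_left _ _)
    · refine (mul_le_mul_of_nonneg_left (hR j (Finset.mem_univ j) k) hε0.le).trans_eq ?_
      rw [hε_def, div_mul_cancel₀ _ hR0.ne']
  · refine gRow_preserves_weightBounded hq x (mul_pos hτ0 hε0) hw0 hu ⟨V, hV⟩
      (σ := τ⁻¹) (inv_nonneg.mpr hτ0.le) (inv_lt_one_of_one_lt₀ hτ1) fun k => ?_
    rw [hw_def, inv_mul_cancel_left₀ hτ0.ne']
    exact le_max_left _ _

end Lattices
end

end LatticeCauchy

/-! ### The dual Cauchy identity as an entry of a matrix identity -/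

theorem mainTheorem6 {𝕜 : Type*} [NormedField 𝕜] [CompleteSpace 𝕜] [DecidableEq 𝕜]
    (n m : ℕ) (lam mu : YoungDiagram)
    (q : 𝕜) (u v : ℕ → 𝕜) (x : Fin n → 𝕜) (y : Fin m → 𝕜)
    (hq : ∀ k : ℕ, q ^ (k + 1) ≠ 1)
    (huv : ∀ k s : ℕ, u k * v k * q ^ s ≠ 1)
    (hvy : ∀ (k : ℕ) (j : Fin m), 1 + v k * y j ≠ 0)
    (hconv : (∃ᶠ k in atTop, v k = 0) ∨
      ∃ C ρ : ℝ, ρ < 1 ∧ ∀ᶠ k in atTop, ‖u k‖ ≤ C ∧ ‖v k‖ ≤ C ∧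
        ∀ j : Fin m, ‖(1 + v k * y j)⁻¹‖ ≤ C ∧
          ‖v k * ((y j + u k) / (1 + v k * y j))‖ ≤ ρ) :
    HasSum
      (fun κ : {κ : YoungDiagram // lam ≤ κ ∧ mu ≤ κ} =>
        LatticeCauchy.cCoeff q u v κ.1.transpose / LatticeCauchy.cCoeff q u v mu.transpose *
          LatticeCauchy.frakG q u v κ.1 lam x *
          LatticeCauchy.frakJ q v u κ.1.transpose mu.transpose y)
      ((∏ j : Fin m, ∏ i : Fin n, (1 + x i * y j)) *
        ∑ᶠ κ : {κ : YoungDiagram // κ ≤ lam ∧ κ ≤ mu},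
          LatticeCauchy.cCoeff q u v lam.transpose / LatticeCauchy.cCoeff q u v κ.1.transpose *
            LatticeCauchy.frakG q u v mu κ.1 x *
            LatticeCauchy.frakJ q v u lam.transpose κ.1.transpose y) := by
  obtain ⟨Good, hG, hJ, hK⟩ := LatticeCauchy.exists_isGrowthClass_preserves hq huv hvy hconv
  set P := LatticeCauchy.kprodRev m fun j => LatticeCauchy.jRow q u v (y j)
  set Q := LatticeCauchy.kprod n fun i => LatticeCauchy.gRow q u v (x i)
  have hP : LatticeCauchy.Preserves Good P := .kprodRev hG hJ
  have hQ : LatticeCauchy.Preserves Good Q := .kprod hG fun i => hK (x i)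
  -- Each dual row is moved through all of `Q`, giving one factor `1 + x i * y j` per crossing.
  have hPQ : LatticeCauchy.kmul P Q =
      (∏ j : Fin m, ∏ i : Fin n, (1 + x i * y j)) • LatticeCauchy.kmul Q P := by
    refine LatticeCauchy.kprodRev_kmul_comm hG _ hQ hJ fun j => ?_
    refine LatticeCauchy.kmul_kprod_comm hG _ (hJ j) (fun i => hK (x i)) fun i => ?_
    refine LatticeCauchy.kmul_jRow_gRow hq huv (x i) (fun k => hvy k j) ?_ fun a c =>
      (hJ j).summable hG (hK (x i)) a c
    rcases hconv with h | ⟨C, ρ, hρ, h⟩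
    · exact Or.inl (h.mono fun k hk => by rw [hk, zero_mul])
    · exact Or.inr ⟨ρ, hρ, h.mono fun k hk => (hk.2.2 j).2⟩
  set e := LatticeCauchy.partitionEquiv
  have hG' : ∀ κ ν, LatticeCauchy.frakG q u v κ ν x = Q (e κ) (e ν) := fun κ ν =>
    LatticeCauchy.latticeZ_eq_kprod q u v x _ _
  have hJ' : ∀ κ ν, LatticeCauchy.cCoeff q u v κ.transpose /
      LatticeCauchy.cCoeff q u v ν.transpose *
        LatticeCauchy.frakJ q v u κ.transpose ν.transpose y = P (e ν) (e κ) := fun κ ν => by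
    rw [LatticeCauchy.cCoeff_eq_stateCoeff, LatticeCauchy.cCoeff_eq_stateCoeff]
    exact LatticeCauchy.latticeZ_eq_kprodRev hq huv hvy _ _
  have hQle : ∀ {κ ν}, Q (e κ) (e ν) ≠ 0 → ν ≤ κ := fun h =>
    LatticeCauchy.le_iff_tail_le.mpr (LatticeCauchy.tail_le_of_kprod_ne_zero h)
  have hPle : ∀ {κ ν}, P (e κ) (e ν) ≠ 0 → κ ≤ ν := fun h =>
    LatticeCauchy.le_iff_tail_le.mpr (LatticeCauchy.tail_le_of_kprodRev_ne_zero hvy h)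
  have hR : ∑ᶠ κ : {κ : YoungDiagram // κ ≤ lam ∧ κ ≤ mu},
      LatticeCauchy.cCoeff q u v lam.transpose / LatticeCauchy.cCoeff q u v κ.1.transpose *
        LatticeCauchy.frakG q u v mu κ.1 x *
        LatticeCauchy.frakJ q v u lam.transpose κ.1.transpose y =
      LatticeCauchy.kmul Q P (e mu) (e lam) := by
    have hfin : Finite {κ : YoungDiagram // κ ≤ lam ∧ κ ≤ mu} :=
      (LatticeCauchy.finite_contained lam mu).to_subtype
    -- The sum over all intermediate states reduces to partitions contained in both `lam` and `mu`,
    -- outside of which one of the two factors vanishes.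
    rw [← tsum_eq_finsum (L := SummationFilter.unconditional _) (Set.toFinite _), LatticeCauchy.kmul, ← e.tsum_eq,
      ← tsum_subtype_eq_of_support_subset (s := {κ | κ ≤ lam ∧ κ ≤ mu})]
    · refine tsum_congr fun κ => ?_
      rw [mul_right_comm, hJ', hG', mul_comm]
    · intro κ hκ
      exact ⟨hPle (right_ne_zero_of_mul hκ), hQle (left_ne_zero_of_mul hκ)⟩
  rw [hR]
  have hsum : HasSum (fun b => P (e mu) b * Q b (e lam)) (LatticeCauchy.kmul P Q (e mu) (e lam)) :=
    (hP.summable hG hQ _ _).hasSum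
  -- Summability was obtained from the growth class before any restriction; passing to the
  -- partitions containing both `lam` and `mu` only drops zero terms.
  rw [hPQ, Pi.smul_apply, Pi.smul_apply, smul_eq_mul, ← e.hasSum_iff,
    ← hasSum_subtype_iff_of_support_subset (s := {κ | lam ≤ κ ∧ mu ≤ κ})] at hsum
  · refine (congrArg (fun f => HasSum f _) (funext fun κ => ?_)).mpr hsum
    rw [mul_right_comm, hJ', hG']
    rfl
  · intro κ hκ
    exact ⟨hQle (right_ne_zero_of_mul hκ), hPle (left_ne_zero_of_mul hκ)⟩
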